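/- Let $\Sigma$ be a finite set, $Q=(q_\sigma)_{\sigma\in\Sigma}$ a probability distribution on $\Sigma$ with all $q_\sigma>0$, and $r_1,\dots,r_k:\Sigma\to\mathbb{R}$ linearly independent functions which are normalized: $\mathbb{E}_Q r_i=0$ and $\mathbb{E}_Q r_ir_j=\delta_{ij}$ for $1\le i,j\le k$. Put $r_0=1$. For $\rho=(\rho_1,\dots,\rho_k)\in\mathbb{R}^k$ near $0$ there are unique real numbers $\lambda_0(\rho),\lambda_1(\rho),\dots,\lambda_k(\rho)$ (the exponential parameters) such that $$p_\sigma=q_\sigma\exp\Bigl(-1-\lambda_0(\rho)-\sum_{i=1}^k\lambda_i(\rho)\,r_i(\sigma)\Bigr)$$ minimizes $D(P\|Q)=\sum_\sigma p_\sigma\log(p_\sigma/q_\sigma)$ among all probability distributions $P$ on $\Sigma$ with $\mathbb{E}_P r_i=\rho_i$ for $1\le i\le k$. A $j$-moment tree is a finite tree $\Gamma$ with a distinguished leaf $v_{out}$ and with edges labeled by elements of $\{0,1,\dots,k\}$, such that every vertex that is not a leaf has valency at least $3$, the edge at $v_{out}$ is labeled $j$, and the edges at the other leaves have labels in $\{1,\dots,k\}$.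 Its leaf multi-index is $I_\Gamma=(a_1,\dots,a_k)$, where $a_i$ is the number of leaves other than $v_{out}$ whose edge is labeled $i$. Its amplitude is $A_\Gamma=\prod_v C_v$, the product over the vertices that are not leaves, where $C_v=(-1)^{d+1}\mathbb{E}_Q(r_{i_1}\cdots r_{i_d})$ for a vertex $v$ of valency $d$ whose edges are labeled $i_1,\dots,i_d$ (so $A_\Gamma=1$ if $\Gamma$ is a single edge). $\mathrm{Aut}(\Gamma)$ is the group of graph automorphisms of $\Gamma$ that fix $v_{out}$ and preserve the edge labels; isomorphisms of moment trees are defined in the same way. Then for $1\le j\le k$ and every multi-index $I=(i_1,\dots,i_k)\in\mathbb{Z}_{\ge0}^k$ there are only finitely many isomorphism types of $j$-moment trees with leaf multi-index $I$, and for all $\rho$ in a neighbourhood of $0$ $$\lambda_j(\rho)=\sum_{I}L_{j,I}\,\rho^I,\qquad L_{j,I}=(-1)^{|I|}\sum_{\Gamma}\frac{A_\Gamma}{|\mathrm{Aut}(\Gamma)|},$$ where the first series converges absolutely, $|I|=i_1+\dots+i_k$, $\rho^I=\prod_m\rho_m^{i_m}$, and $\Gamma$ runs over representatives of the isomorphism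 types of $j$-moment trees with $I_\Gamma=I$. -/

import Mathlib

open scoped Topology

/-- A Kullback-Leibler constraint problem with finite alphabet `A`, reference probability
distribution `q` (with full support) and `k` linearly independent constraint functions
`r 0, …, r (k-1)` (the functions `r_1, …, r_k` of the usual `1`-based numbering). -/
structure KLProblem (A : Type*) [Fintype A] (k : ℕ) where
  q : A → ℝ
  q_pos : ∀ a, 0 < q a
  q_sum : ∑ a, q a = 1
  r : Fin k → A → ℝ
  r_linearIndependent : LinearIndependent ℝ r

namespace KLProblem

variable {A : Type*} [Fintype A] {k : ℕ}

/-- The expectation `E_p f` of an observable `f` with respect to the weights `p`. -/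
def expect (p f : A → ℝ) : ℝ := ∑ a, p a * f a

/-- `E_Q r_i = 0` and `E_Q r_i r_j = δ_ij`. -/
def Normalized (K : KLProblem A k) : Prop :=
  (∀ i, expect K.q (K.r i) = 0) ∧
    ∀ i j, expect K.q (fun a => K.r i a * K.r j a) = if i = j then 1 else 0

/-- The Kullback-Leibler divergence `D(p‖q) = ∑ p_a log (p_a / q_a)` of `p` relative to the
reference distribution (with the convention `0 log 0 = 0`). -/
noncomputable def divergence (K : KLProblem A k) (p : A → ℝ) : ℝ :=
  ∑ a, p a * Real.log (p a / K.q a)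

/-- The probability distributions `p` on the alphabet with `E_p r_i = ρ_i` for all `i`. -/
def feasible (K : KLProblem A k) (ρ : Fin k → ℝ) : Set (A → ℝ) :=
  {p | p ∈ stdSimplex ℝ A ∧ ∀ i, expect p (K.r i) = ρ i}

/-- `p` minimizes the divergence among the probability distributions satisfying the
constraints with right-hand side `ρ`. -/
def IsMinimizer (K : KLProblem A k) (ρ : Fin k → ℝ) (p : A → ℝ) : Prop :=
  p ∈ K.feasible ρ ∧ IsMinOn K.divergence (K.feasible ρ) p

/-- `l = (λ_0, (λ_1, …, λ_k))` are the exponential parameters at `ρ`: the minimizing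
distribution is `p_a = q_a exp (-1 - λ_0 - ∑ λ_i r_i(a))`. -/
def IsExpParameters (K : KLProblem A k) (ρ : Fin k → ℝ) (l : ℝ × (Fin k → ℝ)) : Prop :=
  K.IsMinimizer ρ (fun a => K.q a * Real.exp (-1 - l.1 - ∑ i, l.2 i * K.r i a))

/-- The functions `r_0 = 1, r_1, …, r_k`, indexed by the edge labels. -/
def obs (K : KLProblem A k) : Fin (k + 1) → A → ℝ := Fin.cons (fun _ => 1) K.r

end KLProblem

/-- A moment tree with vertex set `V`: a finite tree with a distinguished leaf `out` whose edges
are labelled by `0, …, k` (label `0` stands for `r_0 = 1`, label `i` for `r_i`), such that every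
vertex that is not a leaf has valency at least `3`, and the edges at the leaves other than `out`
are not labelled `0`. The values of `label` outside the edge set are irrelevant: they are ignored
by isomorphisms and by everything below. -/
structure MomentTree (k : ℕ) (V : Type*) [Fintype V] where
  graph : SimpleGraph V
  isTree : graph.IsTree
  out : V
  label : Sym2 V → Fin (k + 1)
  out_leaf : (graph.neighborSet out).ncard = 1
  valency : ∀ v, (graph.neighborSet v).ncard ≠ 1 → 3 ≤ (graph.neighborSet v).ncard
  leaf_label : ∀ v w, v ≠ out → (graph.neighborSet v).ncard = 1 → graph.Adj v w →
    label s(v, w) ≠ 0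

namespace MomentTree

variable {k : ℕ} {V W X : Type*} [Fintype V] [Fintype W] [Fintype X]

/-- The valency of a vertex. -/
noncomputable def deg (Γ : MomentTree k V) (v : V) : ℕ := (Γ.graph.neighborSet v).ncard

/-- The edge at the distinguished leaf is labelled `j`. -/
def HasOutput (Γ : MomentTree k V) (j : Fin (k + 1)) : Prop :=
  ∀ w, Γ.graph.Adj Γ.out w → Γ.label s(Γ.out, w) = j

/-- The leaf multi-index: entry `i` is the number of leaves, other than the distinguished one,
whose edge carries the label of `r_i`. -/
noncomputable def leafIndex (Γ : MomentTree k V) (i : Fin k) : ℕ :=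
  {v | v ≠ Γ.out ∧ Γ.deg v = 1 ∧
    ∃ w, Γ.graph.Adj v w ∧ Γ.label s(v, w) = i.succ}.ncard

/-- Isomorphisms of moment trees: graph isomorphisms that respect the distinguished leaf and the
labels of the edges. -/
def Iso (Γ : MomentTree k V) (Δ : MomentTree k W) : Type _ :=
  {φ : Γ.graph ≃g Δ.graph // φ Γ.out = Δ.out ∧
    ∀ u v, Γ.graph.Adj u v → Δ.label s(φ u, φ v) = Γ.label s(u, v)}

/-- The automorphisms of a moment tree. -/
abbrev Aut (Γ : MomentTree k V) : Type _ := Iso Γ Γ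

def Iso.refl (Γ : MomentTree k V) : Iso Γ Γ :=
  ⟨RelIso.refl _, rfl, fun _ _ _ => rfl⟩

def Iso.symm {Γ : MomentTree k V} {Δ : MomentTree k W} (φ : Iso Γ Δ) : Iso Δ Γ :=
  ⟨φ.1.symm, (congrArg φ.1.symm φ.2.1).symm.trans (φ.1.symm_apply_apply _), fun u v h => by
    have := φ.2.2 (φ.1.symm u) (φ.1.symm v) (φ.1.symm.map_rel_iff.2 h)
    rw [← this]
    simp⟩

def Iso.trans {Γ : MomentTree k V} {Δ : MomentTree k W} {Θ : MomentTree k X}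
    (φ : Iso Γ Δ) (ψ : Iso Δ Θ) : Iso Γ Θ :=
  ⟨φ.1.trans ψ.1, by
      change ψ.1 (φ.1 Γ.out) = Θ.out
      rw [φ.2.1, ψ.2.1], fun u v h => by
      change Θ.label s(ψ.1 (φ.1 u), ψ.1 (φ.1 v)) = Γ.label s(u, v)
      rw [ψ.2.2 _ _ (φ.1.map_rel_iff.2 h), φ.2.2 u v h]⟩

section Amplitude

variable {A : Type*} [Fintype A]

open Classical in
/-- The coupling value `(-1)^(d+1) E_Q (r_{i_1} ⋯ r_{i_d})` of a vertex of valency `d` whose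
edges carry the labels `i_1, …, i_d`. -/
noncomputable def coupling (K : KLProblem A k) (Γ : MomentTree k V) (v : V) : ℝ :=
  (-1) ^ (Γ.deg v + 1) *
    KLProblem.expect K.q
      (fun a => ∏ w ∈ Finset.univ.filter (Γ.graph.Adj v), K.obs (Γ.label s(v, w)) a)

open Classical in
/-- The amplitude: the product of the coupling values of the inner vertices, that is, of the
vertices that are not leaves (so it is `1` for a tree consisting of a single edge). -/
noncomputable def amplitude (K : KLProblem A k) (Γ : MomentTree k V) : ℝ :=
  ∏ v ∈ Finset.univ.filter (fun v => Γ.deg v ≠ 1), Γ.coupling K v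

end Amplitude

end MomentTree

/-- The `j`-moment trees with leaf multi-index `I` on the vertex sets `Fin n`, `n ∈ ℕ`. Every
finite tree is isomorphic to one of this kind. -/
structure IndexedMomentTree (k : ℕ) (j : Fin (k + 1)) (I : Fin k → ℕ) where
  n : ℕ
  tree : MomentTree k (Fin n)
  hasOutput : tree.HasOutput j
  leafIndex_eq : tree.leafIndex = I

/-- Isomorphism of `j`-moment trees with leaf multi-index `I`. -/
def IndexedMomentTree.setoid (k : ℕ) (j : Fin (k + 1)) (I : Fin k → ℕ) :
    Setoid (IndexedMomentTree k j I) where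
  r Γ Δ := Nonempty (MomentTree.Iso Γ.tree Δ.tree)
  iseqv :=
    { refl := fun Γ => ⟨MomentTree.Iso.refl Γ.tree⟩
      symm := fun ⟨φ⟩ => ⟨φ.symm⟩
      trans := fun ⟨φ⟩ ⟨ψ⟩ => ⟨φ.trans ψ⟩ }

/-- The isomorphism types of `j`-moment trees with leaf multi-index `I`. -/
def MomentTreeType (k : ℕ) (j : Fin (k + 1)) (I : Fin k → ℕ) : Type :=
  Quotient (IndexedMomentTree.setoid k j I)

/-- A representative of an isomorphism type. -/
noncomputable def MomentTreeType.rep {k : ℕ} {j : Fin (k + 1)} {I : Fin k → ℕ}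
    (c : MomentTreeType k j I) : IndexedMomentTree k j I :=
  Quotient.out c

/-- The power series `∑_I c_I ρ^I` in `k` real variables converges (absolutely) to `f` in a
neighbourhood of the origin, so that `f` is analytic at `0` and the `c_I` are its Taylor
coefficients there. -/
def HasTaylorCoefficients {k : ℕ} (f : (Fin k → ℝ) → ℝ) (c : (Fin k → ℕ) → ℝ) : Prop :=
  ∀ᶠ ρ in 𝓝 (0 : Fin k → ℝ), HasSum (fun I => c I * ∏ i, ρ i ^ I i) (f ρ)

/-! Write Y = Σ_{j≥0} y_j r_j with y_0 = 1 + λ_0 and y_j = λ_j for j ≥ 1. If the density g = q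
e^{-Y} is feasible, it is the minimizer: for feasible p, D(p) - D(g) = Σ (p log(p/g) - p + g), whose
terms are nonnegative and vanish only where p = g (`divergence_sub_divergence_gibbs`). So the
exponential parameters are the solutions of the moment equations E_Q(r_j e^{-Y}) = ρ_j, with ρ_0 =
1, and they are unique. By orthonormality E_Q(r_j Y) = y_j, so expanding e^{-Y} turns the moment
equations into the fixed-point system y_j = x_j + Σ_{n≥2} (-1)^n/n! · E_Q(r_j Y^n), where x_0 = 0
and x_i = -ρ_i.

A planar tree is a leaf or a root with n ≥ 2 ordered subtrees, so the sum of suitable weights over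
all planar trees with root label j solves this system (`treeSum_eq`). For small x it converges
absolutely by comparison with a majorant (`tsum_majorant_le`), so by uniqueness it equals λ_j for j
≥ 1.

It remains to collect the planar trees with the same underlying moment tree Γ. The weight of T is
its amplitude times its leaf values, divided by the product `symmetry` of the factorials of the
numbers of children. A planar tree together with an isomorphism onto Γ amounts to an ordering of the
children at every vertex of Γ; hence Σ_T |Iso(T, Γ)| / symmetry(T) = 1 (`hasSum_card_iso`). Every
nonempty Iso(T, Γ) has |Aut Γ| elements, so the planar trees over Γ have total mass 1/|Aut Γ|
(`hasSum_symmetry_inv`). -/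

/-- Planar rooted trees with labelled edges. The label of a leaf or a node is that of the edge
above it; a node has `d + 2` linearly ordered children. -/
inductive PlanarTree (k : ℕ) : Type
  | leaf (i : Fin k) : PlanarTree k
  | node (l : Fin (k + 1)) (d : ℕ) (c : Fin (d + 2) → PlanarTree k) : PlanarTree k

/-! ### Sums of products over tuples -/

theorem ENNReal.tsum_pi_prod {β : Type*} {n : ℕ} (f : Fin n → β → ENNReal) :
    ∑' c : Fin n → β, ∏ i, f i (c i) = ∏ i, ∑' b, f i b := by
  induction n with
  | zero => simp [tsum_fintype]
  | succ n ih =>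
    rw [← (Fin.consEquiv (fun _ : Fin (n + 1) => β)).tsum_eq, ENNReal.tsum_prod']
    simp only [Fin.consEquiv, Equiv.coe_fn_mk, Fin.prod_univ_succ, Fin.cons_zero, Fin.cons_succ,
      ENNReal.tsum_mul_left, ENNReal.tsum_mul_right, ih (fun i => f i.succ)]

theorem summable_norm_and_hasSum_pi_prod {β : Type*} {n : ℕ} (f : Fin n → β → ℝ)
    (hf : ∀ i, Summable fun b => ‖f i b‖) :
    (Summable fun c : Fin n → β => ‖∏ i, f i (c i)‖) ∧
      HasSum (fun c : Fin n → β => ∏ i, f i (c i)) (∏ i, ∑' b, f i b) := by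
  induction n with
  | zero => exact ⟨(hasSum_fintype _).summable, by simp⟩
  | succ n ih =>
    obtain ⟨h₁, h₂⟩ := ih (fun i => f i.succ) (fun i => hf i.succ)
    let e := Fin.consEquiv (fun _ : Fin (n + 1) => β)
    have key : ∀ p : β × (Fin n → β), ∏ i, f i (e p i) = f 0 p.1 * ∏ i : Fin n, f i.succ (p.2 i) :=
      fun p => by simp [e, Fin.consEquiv, Fin.prod_univ_succ]
    constructor
    · rw [← e.summable_iff]
      simpa only [Function.comp_def, key] using Summable.mul_norm (hf 0) h₁
    · rw [← e.hasSum_iff, Fin.prod_univ_succ]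
      simp only [Function.comp_def, key]
      rw [← h₂.tsum_eq, tsum_mul_tsum_of_summable_norm (hf 0) h₁]
      exact (summable_mul_of_summable_norm (hf 0) h₁).hasSum

/-! ### Planar trees and the convergence of their majorant -/

namespace PlanarTree

variable {k : ℕ}

/-- The children of a node, given its label and its number of children (minus two). -/
abbrev Nodes (k : ℕ) : Type := Σ p : Fin (k + 1) × ℕ, (Fin (p.2 + 2) → PlanarTree k)

def equivSum (k : ℕ) : Fin k ⊕ Nodes k ≃ PlanarTree k where
  toFun
    | Sum.inl i => leaf i
    | Sum.inr x => node x.1.1 x.1.2 x.2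
  invFun
    | leaf i => Sum.inl i
    | node l d c => Sum.inr ⟨(l, d), c⟩
  left_inv := by rintro (i | x) <;> rfl
  right_inv := by rintro (i | ⟨l, d, c⟩) <;> rfl

theorem hasSum {M : Type*} [AddCommMonoid M] [TopologicalSpace M] [ContinuousAdd M]
    {f : PlanarTree k → M} {b : M}
    (h : HasSum (fun x : Nodes k => f (node x.1.1 x.1.2 x.2)) b) :
    HasSum f (∑ i, f (leaf i) + b) := by
  rw [← (equivSum k).hasSum_iff]
  exact HasSum.sum (hasSum_fintype _) h

theorem tsum_ennreal (f : PlanarTree k → ENNReal) :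
    ∑' T, f T = ∑ i, f (leaf i) +
      ∑' p : Fin (k + 1) × ℕ, ∑' c : Fin (p.2 + 2) → PlanarTree k, f (node p.1 p.2 c) := by
  rw [← ENNReal.tsum_sigma' (fun x : Nodes k => f (node x.1.1 x.1.2 x.2))]
  exact (hasSum ENNReal.summable.hasSum).tsum_eq

/-- The label of the edge above the root. -/
def lab : PlanarTree k → Fin (k + 1)
  | leaf i => i.succ
  | node l _ _ => l

/-- A majorant of the weights of planar trees. -/
noncomputable def majorant (e B : ENNReal) : PlanarTree k → ENNReal
  | leaf _ => e
  | node _ _ c => B * ∏ i, majorant e B (c i)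

/-- The majorant, restricted to the trees of height less than `N`. -/
noncomputable def truncatedMajorant (e B : ENNReal) : ℕ → PlanarTree k → ENNReal
  | 0, _ => 0
  | _ + 1, leaf _ => e
  | N + 1, node _ _ c => B * ∏ i, truncatedMajorant e B N (c i)

theorem eventually_truncatedMajorant_eq (e B : ENNReal) (T : PlanarTree k) :
    ∀ᶠ N in Filter.atTop, truncatedMajorant e B N T = majorant e B T := by
  induction T with
  | leaf i =>
    filter_upwards [Filter.eventually_ge_atTop 1] with N hN
    obtain ⟨N, rfl⟩ := Nat.exists_eq_add_of_le' hN
    rfl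
  | node l d c ih =>
    have h := Filter.eventually_all.2 ih
    rw [← Filter.map_add_atTop_eq_nat 1, Filter.eventually_map]
    filter_upwards [h] with N hN
    simp [truncatedMajorant, majorant, hN]

/-- Splitting at the root gives S_{N+1} = k e + (k+1) B Σ_d S_N^(d+2) for the truncated sums S_N,
and `h` says that this map sends [0, δ] into itself. The full sum satisfies the same equation, but
that alone would not exclude the value ∞. -/
theorem tsum_truncatedMajorant_le {e B δ : ℝ} (he : 0 ≤ e) (hB : 0 ≤ B) (hδ : 0 ≤ δ) (hδ1 : δ < 1)
    (h : k * e + (k + 1) * (B * (δ ^ 2 / (1 - δ))) ≤ δ) (N : ℕ) :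
    ∑' T : PlanarTree k, truncatedMajorant (ENNReal.ofReal e) (ENNReal.ofReal B) N T ≤
      ENNReal.ofReal δ := by
  induction N with
  | zero => simp [truncatedMajorant]
  | succ N ih =>
    rw [tsum_ennreal]
    simp only [truncatedMajorant, Finset.sum_const, Finset.card_univ, Fintype.card_fin]
    have hgeom : HasSum (fun d : ℕ => δ ^ (d + 2)) (δ ^ 2 / (1 - δ)) := by
      have := (hasSum_geometric_of_lt_one hδ hδ1).mul_left (δ ^ 2)
      simpa [pow_add, mul_comm, div_eq_mul_inv] using this
    calc _ ≤ k • ENNReal.ofReal e + ∑' p : Fin (k + 1) × ℕ,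
          ENNReal.ofReal B * ENNReal.ofReal δ ^ (p.2 + 2) := by
          gcongr with p
          rw [ENNReal.tsum_mul_left, ENNReal.tsum_pi_prod (fun _ => truncatedMajorant _ _ N)]
          simp only [Finset.prod_const, Finset.card_univ, Fintype.card_fin]
          gcongr
      _ = ENNReal.ofReal (k * e + (k + 1) * (B * (δ ^ 2 / (1 - δ)))) := by
          rw [ENNReal.tsum_prod', ENNReal.ofReal_add (by positivity)
            (by have := sub_pos.2 hδ1; positivity)]
          congr 1
          · rw [nsmul_eq_mul, ENNReal.ofReal_mul (by positivity), ENNReal.ofReal_natCast]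
          · simp only [ENNReal.tsum_mul_left, ← ENNReal.ofReal_pow hδ]
            rw [← ENNReal.ofReal_tsum_of_nonneg (fun _ => by positivity) hgeom.summable,
              hgeom.tsum_eq, tsum_fintype, Finset.sum_const, Finset.card_univ, Fintype.card_fin,
              nsmul_eq_mul, ENNReal.ofReal_mul (by positivity), ENNReal.ofReal_mul hB]
            norm_cast
            ring
      _ ≤ _ := ENNReal.ofReal_le_ofReal h

/-- The finitely many trees of a partial sum have bounded height, so a single truncation agrees with
the majorant on all of them. -/
theorem tsum_majorant_le {e B δ : ℝ} (he : 0 ≤ e) (hB : 0 ≤ B) (hδ : 0 ≤ δ) (hδ1 : δ < 1)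
    (h : k * e + (k + 1) * (B * (δ ^ 2 / (1 - δ))) ≤ δ) :
    ∑' T : PlanarTree k, majorant (ENNReal.ofReal e) (ENNReal.ofReal B) T ≤ ENNReal.ofReal δ := by
  rw [ENNReal.tsum_eq_iSup_sum]
  refine iSup_le fun s => ?_
  obtain ⟨N, hN⟩ := ((Filter.eventually_all_finset s).2 fun T _ =>
    eventually_truncatedMajorant_eq (ENNReal.ofReal e) (ENNReal.ofReal B) T).exists
  rw [← Finset.sum_congr rfl hN]
  exact (ENNReal.sum_le_tsum s).trans (tsum_truncatedMajorant_le he hB hδ hδ1 h N)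

end PlanarTree

/-! ### Weights of planar trees and the fixed-point equation -/

namespace KLProblem

variable {A : Type*} [Fintype A] {k : ℕ}

/-- The weight of a planar tree: the product of the couplings of its nodes, divided by the
factorials of their numbers of children, and of the values `x i` of its leaves. -/
noncomputable def weight (K : KLProblem A k) (x : Fin k → ℝ) : PlanarTree k → ℝ
  | .leaf i => x i
  | .node l d c => (-1) ^ d / (d + 2).factorial *
      expect K.q (fun a => K.obs l a * ∏ i, K.obs (c i).lab a) * ∏ i, weight K x (c i)

theorem abs_expect_le (K : KLProblem A k) {f : A → ℝ} {C : ℝ} (h : ∀ a, |f a| ≤ C) :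
    |expect K.q f| ≤ C := by
  calc |expect K.q f| ≤ ∑ a, |K.q a * f a| := Finset.abs_sum_le_sum_abs _ _
    _ ≤ ∑ a, K.q a * C := Finset.sum_le_sum fun a _ => by
        rw [abs_mul, abs_of_pos (K.q_pos a)]
        exact mul_le_mul_of_nonneg_left (h a) (K.q_pos a).le
    _ = C := by rw [← Finset.sum_mul, K.q_sum, one_mul]

theorem exists_obs_bound (K : KLProblem A k) : ∃ M : ℝ, 1 ≤ M ∧ ∀ j a, |K.obs j a| ≤ M := by
  refine ⟨1 + ∑ j, ∑ a, |K.obs j a|, ?_, fun j a => ?_⟩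
  · have : 0 ≤ ∑ j, ∑ a, |K.obs j a| := by positivity
    linarith
  · have h₁ := Finset.single_le_sum (f := fun a => |K.obs j a|) (fun _ _ => abs_nonneg _)
      (Finset.mem_univ a)
    have h₂ := Finset.single_le_sum (f := fun j => ∑ a, |K.obs j a|)
      (fun _ _ => Finset.sum_nonneg fun _ _ => abs_nonneg _) (Finset.mem_univ j)
    linarith

/-- The expectation at a node with d + 2 children is at most M^(d+3). One factor M goes to each
child, and the remaining one joins the M in front of the weight to give M². The inverse factorial is
only bounded by 1. -/
theorem abs_weight_le (K : KLProblem A k) {M e : ℝ} (hM : 1 ≤ M) (hobs : ∀ j a, |K.obs j a| ≤ M)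
    {x : Fin k → ℝ} (hx : ∀ i, M * |x i| ≤ e) (T : PlanarTree k) :
    ENNReal.ofReal (M * |K.weight x T|) ≤
      T.majorant (ENNReal.ofReal e) (ENNReal.ofReal (M ^ 2)) := by
  have hM0 : 0 ≤ M := by linarith
  induction T with
  | leaf i => exact ENNReal.ofReal_le_ofReal (hx i)
  | node l d c ih =>
    calc _ ≤ ENNReal.ofReal (M ^ 2 * ∏ i, (M * |K.weight x (c i)|)) := by
          refine ENNReal.ofReal_le_ofReal ?_
          rw [weight, abs_mul, abs_mul, Finset.abs_prod, Finset.prod_mul_distrib]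
          simp only [Finset.prod_const, Finset.card_univ, Fintype.card_fin]
          have h₁ : |(-1 : ℝ) ^ d / (d + 2).factorial| ≤ 1 := by
            rw [abs_div, abs_pow, abs_neg, abs_one, one_pow, Nat.abs_cast]
            exact div_le_one_of_le₀ (by exact_mod_cast Nat.succ_le_of_lt (Nat.factorial_pos _))
              (by positivity)
          have h₂ : |expect K.q (fun a => K.obs l a * ∏ i, K.obs (c i).lab a)| ≤ M * M ^ (d + 2) := by
            refine K.abs_expect_le fun a => ?_
            rw [abs_mul, Finset.abs_prod]
            refine mul_le_mul (hobs l a) ?_ (by positivity) hM0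
            refine (Finset.prod_le_prod (fun _ _ => abs_nonneg _) fun i _ => hobs _ a).trans ?_
            simp
          have h₃ := mul_le_mul h₁ h₂ (abs_nonneg _) zero_le_one
          have h₄ : 0 ≤ ∏ i, |K.weight x (c i)| := by positivity
          nlinarith [mul_le_mul_of_nonneg_left (mul_le_mul_of_nonneg_right h₃ h₄) hM0]
      _ ≤ _ := by
          rw [ENNReal.ofReal_mul (by positivity),
            ENNReal.ofReal_prod_of_nonneg (fun _ _ => by positivity), PlanarTree.majorant]
          gcongr with i
          exact ih i

theorem exists_summable_weight (K : KLProblem A k) :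
    ∃ ε > 0, ∀ x : Fin k → ℝ, (∀ i, |x i| ≤ ε) → Summable fun T => ‖K.weight x T‖ := by
  obtain ⟨M, hM, hobs⟩ := K.exists_obs_bound
  have hM0 : 0 < M := by linarith
  -- As δ ≤ 1/4, the geometric tail is at most 2δ²; this δ makes (k+1) M² · 2δ² equal to δ/2. The
  -- leaves get the other half through e = δ / (2(k+1)).
  set δ : ℝ := 1 / (4 * (k + 1) * M ^ 2) with hδ
  have hD : (4 : ℝ) ≤ 4 * (k + 1) * M ^ 2 := by
    have : (1 : ℝ) ≤ (k + 1) * M ^ 2 :=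
      one_le_mul_of_one_le_of_one_le (by simp) (one_le_pow₀ hM)
    linarith
  have hδ0 : 0 < δ := by positivity
  have hδ4 : δ ≤ 1 / 4 := one_div_le_one_div_of_le (by norm_num) hD
  set e : ℝ := δ / (2 * (k + 1)) with he
  have he0 : 0 < e := by positivity
  have hmain : k * e + (k + 1) * (M ^ 2 * (δ ^ 2 / (1 - δ))) ≤ δ := by
    have h₁ : k * e ≤ δ / 2 := by
      have : (k + 1) * e = δ / 2 := by rw [he]; field_simp
      linarith
    have h₂ : δ ^ 2 / (1 - δ) ≤ 2 * δ ^ 2 := by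
      rw [div_le_iff₀ (by linarith)]
      nlinarith [sq_nonneg δ]
    have h₃ : (k + 1) * (M ^ 2 * (2 * δ ^ 2)) = δ / 2 := by
      rw [hδ]; field_simp; norm_num
    have h₄ : (k + 1) * (M ^ 2 * (δ ^ 2 / (1 - δ))) ≤ (k + 1) * (M ^ 2 * (2 * δ ^ 2)) := by gcongr
    linarith
  refine ⟨e / M, by positivity, fun x hx => ?_⟩
  have hx' : ∀ i, M * |x i| ≤ e := fun i => by
    have := hx i
    rwa [le_div_iff₀ hM0, mul_comm] at this
  have hfin : ∑' T, ENNReal.ofReal (M * |K.weight x T|) ≠ ⊤ := by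
    refine ne_top_of_le_ne_top ENNReal.ofReal_ne_top
      ((ENNReal.tsum_le_tsum (K.abs_weight_le hM hobs hx')).trans
        (PlanarTree.tsum_majorant_le he0.le (by positivity) hδ0.le (by linarith) hmain))
  have hs := ENNReal.summable_toReal hfin
  simp only [ENNReal.toReal_ofReal (mul_nonneg hM0.le (abs_nonneg _))] at hs
  exact (summable_mul_left_iff hM0.ne').1 hs

theorem hasSum_exp_neg_sub (y : ℝ) :
    HasSum (fun d : ℕ => (-1) ^ d / ((d + 2).factorial : ℝ) * y ^ (d + 2))
      (Real.exp (-y) - 1 + y) := by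
  have h := NormedSpace.expSeries_div_hasSum_exp (-y)
  rw [← Real.exp_eq_exp_ℝ] at h
  have h2 := (hasSum_nat_add_iff' 2).2 h
  have e₁ : Real.exp (-y) - 1 + y =
      Real.exp (-y) - ∑ i ∈ Finset.range 2, (-y) ^ i / (i.factorial : ℝ) := by
    simp [Finset.sum_range_succ]
    ring
  have e₂ : (fun d : ℕ => (-1) ^ d / ((d + 2).factorial : ℝ) * y ^ (d + 2)) =
      fun d => (-y) ^ (d + 2) / ((d + 2).factorial : ℝ) := funext fun d => by
    rw [neg_pow y, pow_add (-1 : ℝ) d 2]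
    ring
  rw [e₁, e₂]
  exact h2

/-- The sum of the weights of the planar trees whose root carries the label `j`. -/
noncomputable def treeSum (K : KLProblem A k) (x : Fin k → ℝ) (j : Fin (k + 1)) : ℝ :=
  ∑' T : PlanarTree k, if T.lab = j then K.weight x T else 0

variable {K : KLProblem A k} {x : Fin k → ℝ}

theorem summable_weight_ite (h : Summable fun T => ‖K.weight x T‖) (j : Fin (k + 1)) :
    Summable fun T : PlanarTree k => if T.lab = j then K.weight x T else 0 := by
  refine Summable.of_norm_bounded h fun T => ?_
  split_ifs <;> simp

theorem hasSum_weight_mul_obs (h : Summable fun T => ‖K.weight x T‖) (a : A) :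
    HasSum (fun T : PlanarTree k => K.weight x T * K.obs T.lab a)
      (∑ j, K.treeSum x j * K.obs j a) := by
  have := hasSum_sum (s := Finset.univ) fun j _ =>
    (summable_weight_ite h j).hasSum.mul_right (K.obs j a)
  have e : (fun T : PlanarTree k => K.weight x T * K.obs T.lab a) = fun T =>
      ∑ j, (if T.lab = j then K.weight x T else 0) * K.obs j a := funext fun T => by
    simp [ite_mul]
  rw [e]
  exact this

theorem summable_norm_weight_mul_obs (h : Summable fun T => ‖K.weight x T‖) (a : A) :
    Summable fun T : PlanarTree k => ‖K.weight x T * K.obs T.lab a‖ := by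
  obtain ⟨M, hM, hobs⟩ := K.exists_obs_bound
  refine Summable.of_nonneg_of_le (fun _ => norm_nonneg _) (fun T => ?_) (h.mul_right M)
  rw [norm_mul]
  exact mul_le_mul_of_nonneg_left (hobs _ a) (norm_nonneg _)

theorem hasSum_prod_weight_mul_obs (h : Summable fun T => ‖K.weight x T‖) (a : A) (n : ℕ) :
    HasSum (fun c : Fin n → PlanarTree k => ∏ i, (K.weight x (c i) * K.obs (c i).lab a))
      ((∑ j, K.treeSum x j * K.obs j a) ^ n) := by
  have := (summable_norm_and_hasSum_pi_prod (n := n) (fun _ T => K.weight x T * K.obs T.lab a)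
    (fun _ => summable_norm_weight_mul_obs h a)).2
  rw [(hasSum_weight_mul_obs h a).tsum_eq, Finset.prod_const, Finset.card_univ,
    Fintype.card_fin] at this
  exact this

/-- For fixed a, the sum over tuples of subtrees factors into the (d+2)-th power of Σ_j y_j r_j(a);
the expectation is a finite sum over a and commutes with the series. -/
theorem hasSum_weight_node (h : Summable fun T => ‖K.weight x T‖) (l : Fin (k + 1)) (d : ℕ) :
    HasSum (fun c : Fin (d + 2) → PlanarTree k => K.weight x (.node l d c))
      ((-1) ^ d / (d + 2).factorial *
        expect K.q (fun a => K.obs l a * (∑ j, K.treeSum x j * K.obs j a) ^ (d + 2))) := by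
  have := (hasSum_sum (s := Finset.univ) fun a _ =>
    ((hasSum_prod_weight_mul_obs h a (d + 2)).mul_left (K.q a * K.obs l a))).mul_left
      ((-1) ^ d / ((d + 2).factorial : ℝ))
  have e : (fun c : Fin (d + 2) → PlanarTree k => K.weight x (.node l d c)) = fun c =>
      (-1) ^ d / ((d + 2).factorial : ℝ) * ∑ a, K.q a * K.obs l a *
        ∏ i, (K.weight x (c i) * K.obs (c i).lab a) := funext fun c => by
    rw [weight, expect, mul_assoc, Finset.sum_mul]
    congr 1
    refine Finset.sum_congr rfl fun a _ => ?_
    rw [Finset.prod_mul_distrib]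
    ring
  rw [e, expect]
  simp only [← mul_assoc] at this ⊢
  exact this

theorem hasSum_expect_pow (Y : A → ℝ) (f : A → ℝ) :
    HasSum (fun d : ℕ => (-1) ^ d / ((d + 2).factorial : ℝ) *
      expect K.q (fun a => f a * Y a ^ (d + 2)))
      (expect K.q (fun a => f a * (Real.exp (-Y a) - 1 + Y a))) := by
  have := hasSum_sum (s := Finset.univ) fun a _ =>
    (hasSum_exp_neg_sub (Y a)).mul_left (K.q a * f a)
  have e : (fun d : ℕ => (-1) ^ d / ((d + 2).factorial : ℝ) *
      expect K.q (fun a => f a * Y a ^ (d + 2))) = fun d => ∑ a, K.q a * f a *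
        ((-1) ^ d / ((d + 2).factorial : ℝ) * Y a ^ (d + 2)) := funext fun d => by
    rw [expect, Finset.mul_sum]
    refine Finset.sum_congr rfl fun a _ => ?_
    ring
  rw [e, expect]
  simp only [← mul_assoc] at this ⊢
  exact this

/-- Leaves contribute x, and the nodes labelled j with d + 2 children contribute the term of order d
+ 2 of E_Q(r_j e^{-Y}). Since no node has fewer than two children, the terms of order 0 and 1 of the
exponential are removed. -/
theorem treeSum_eq (h : Summable fun T => ‖K.weight x T‖) (j : Fin (k + 1)) :
    K.treeSum x j = (∑ i : Fin k, if i.succ = j then x i else 0) +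
      expect K.q (fun a => K.obs j a * (Real.exp (-∑ j, K.treeSum x j * K.obs j a) - 1 +
        ∑ j, K.treeSum x j * K.obs j a)) := by
  have hs : Summable fun z : PlanarTree.Nodes k =>
      if (PlanarTree.node z.1.1 z.1.2 z.2).lab = j then
        K.weight x (.node z.1.1 z.1.2 z.2) else 0 :=
    (summable_weight_ite h j).comp_injective (i := fun z : PlanarTree.Nodes k =>
      PlanarTree.node z.1.1 z.1.2 z.2) ((PlanarTree.equivSum k).injective.comp Sum.inr_injective)
  let g : Fin (k + 1) × ℕ → ℝ := fun p => if p.1 = j then (-1) ^ p.2 / (p.2 + 2).factorial *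
        expect K.q (fun a => K.obs j a * (∑ j, K.treeSum x j * K.obs j a) ^ (p.2 + 2)) else 0
  have hfib : ∀ p : Fin (k + 1) × ℕ, HasSum (fun c : Fin (p.2 + 2) → PlanarTree k =>
      if (PlanarTree.node p.1 p.2 c).lab = j then K.weight x (.node p.1 p.2 c) else 0) (g p) := by
    rintro ⟨l, d⟩
    by_cases hl : l = j
    · subst hl
      simpa only [g, PlanarTree.lab, if_true] using hasSum_weight_node h l d
    · have e : (fun c : Fin (d + 2) → PlanarTree k =>
          if (PlanarTree.node l d c).lab = j then K.weight x (.node l d c) else 0) = fun _ => 0 :=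
        funext fun c => if_neg hl
      have e' : g (l, d) = 0 := if_neg hl
      rw [e', e]
      exact hasSum_zero
  have h₁ := hs.hasSum.sigma hfib
  have h₂ : HasSum g (expect K.q (fun a => K.obs j a *
      (Real.exp (-∑ j, K.treeSum x j * K.obs j a) - 1 + ∑ j, K.treeSum x j * K.obs j a))) := by
    -- `g` is supported on the root label j, so only the sum over d is left.
    refine ((Prod.mk_right_injective j).hasSum_iff fun p hp => ?_).1 ?_
    · refine if_neg fun hpj => hp ⟨p.2, ?_⟩
      rw [← hpj]
    · have e : g ∘ Prod.mk j = fun d : ℕ => (-1) ^ d / ((d + 2).factorial : ℝ) *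
          expect K.q (fun a => K.obs j a * (∑ j, K.treeSum x j * K.obs j a) ^ (d + 2)) :=
        funext fun d => if_pos rfl
      rw [e]
      exact hasSum_expect_pow _ _
  have h₃ := (PlanarTree.hasSum (f := fun T => if T.lab = j then K.weight x T else 0)
    hs.hasSum).tsum_eq
  rw [h₁.unique h₂] at h₃
  exact h₃

end KLProblem

/-! ### The exponential family and the minimization problem -/

namespace KLProblem

variable {A : Type*} [Fintype A] {k : ℕ} {K : KLProblem A k}

theorem Normalized.expect_obs_mul_obs (hK : K.Normalized) (i j : Fin (k + 1)) :
    expect K.q (fun a => K.obs i a * K.obs j a) = if i = j then 1 else 0 := by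
  refine Fin.cases ?_ (fun i => ?_) i <;> refine Fin.cases ?_ (fun j => ?_) j
  · simp [obs, expect, K.q_sum]
  · simpa [obs, (Fin.succ_ne_zero j).symm] using hK.1 j
  · simpa [obs] using hK.1 i
  · simpa [obs] using hK.2 i j

theorem Normalized.expect_obs_mul_sum (hK : K.Normalized) (y : Fin (k + 1) → ℝ) (j : Fin (k + 1)) :
    expect K.q (fun a => K.obs j a * ∑ i, y i * K.obs i a) = y j := by
  calc _ = ∑ i, y i * expect K.q (fun a => K.obs j a * K.obs i a) := by
        simp only [expect, Finset.mul_sum]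
        rw [Finset.sum_comm]
        refine Finset.sum_congr rfl fun i _ => Finset.sum_congr rfl fun a _ => ?_
        ring
    _ = y j := by simp [hK.expect_obs_mul_obs]

/-- The member of the exponential family with parameters `l`. -/
noncomputable def gibbs (K : KLProblem A k) (l : ℝ × (Fin k → ℝ)) (a : A) : ℝ :=
  K.q a * Real.exp (-1 - l.1 - ∑ i, l.2 i * K.r i a)

theorem gibbs_pos (l : ℝ × (Fin k → ℝ)) (a : A) : 0 < K.gibbs l a :=
  mul_pos (K.q_pos a) (Real.exp_pos _)

/-- The logarithm of the density is affine in the constraint functions, so its mean is the same for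
all feasible p. -/
theorem sum_mul_exponent {ρ : Fin k → ℝ} {p : A → ℝ} (hp : p ∈ K.feasible ρ)
    (l : ℝ × (Fin k → ℝ)) :
    ∑ a, p a * (-1 - l.1 - ∑ i, l.2 i * K.r i a) = -1 - l.1 - ∑ i, l.2 i * ρ i := by
  have h₁ : ∑ a, p a * ∑ i, l.2 i * K.r i a = ∑ i, l.2 i * ρ i := by
    simp only [← hp.2, expect, Finset.mul_sum]
    rw [Finset.sum_comm]
    refine Finset.sum_congr rfl fun i _ => Finset.sum_congr rfl fun a _ => ?_
    ring
  simp only [mul_sub, Finset.sum_sub_distrib, h₁, ← Finset.sum_mul, hp.1.2, one_mul]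

theorem gibbs_gap_nonneg {x y : ℝ} (hx : 0 ≤ x) (hy : 0 < y) : 0 ≤ x * Real.log (x / y) - x + y := by
  rcases hx.eq_or_lt with rfl | hx
  · simpa using hy.le
  · have h := Real.log_le_sub_one_of_pos (div_pos hy hx)
    rw [← inv_div, Real.log_inv] at h
    have : x * (x / y)⁻¹ = y := by field_simp
    nlinarith [mul_le_mul_of_nonneg_left h hx.le]

theorem eq_of_gibbs_gap_eq_zero {x y : ℝ} (hx : 0 < x) (hy : 0 < y)
    (h : x * Real.log (x / y) - x + y = 0) : x = y := by
  by_contra hne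
  have hlt := Real.log_lt_sub_one_of_pos (div_pos hy hx) fun h1 => hne
    ((div_eq_one_iff_eq hx.ne').1 h1).symm
  rw [← inv_div, Real.log_inv] at hlt
  have : x * (x / y)⁻¹ = y := by field_simp
  nlinarith [mul_lt_mul_of_pos_left hlt hx]

/-- Write log(p/q) = log(p/g) + log(g/q): the second term has the same mean under p and g. Adding -p
+ g costs nothing, as both have mass 1, and makes every summand nonnegative. -/
theorem divergence_sub_divergence_gibbs {ρ : Fin k → ℝ} {p : A → ℝ} (hp : p ∈ K.feasible ρ)
    {l : ℝ × (Fin k → ℝ)} (hl : K.gibbs l ∈ K.feasible ρ) :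
    K.divergence p - K.divergence (K.gibbs l) =
      ∑ a, (p a * Real.log (p a / K.gibbs l a) - p a + K.gibbs l a) := by
  have h₁ : K.divergence (K.gibbs l) = -1 - l.1 - ∑ i, l.2 i * ρ i := by
    rw [← sum_mul_exponent hl, divergence]
    refine Finset.sum_congr rfl fun a _ => ?_
    rw [gibbs, mul_div_cancel_left₀ _ (K.q_pos a).ne', Real.log_exp]
  have h₂ : K.divergence p = ∑ a, p a * Real.log (p a / K.gibbs l a) +
      ∑ a, p a * (-1 - l.1 - ∑ i, l.2 i * K.r i a) := by
    rw [← Finset.sum_add_distrib, divergence]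
    refine Finset.sum_congr rfl fun a _ => ?_
    rcases (hp.1.1 a).eq_or_lt with h0 | h0
    · simp [← h0]
    · rw [← mul_add, gibbs, ← div_div, Real.log_div (div_pos h0 (K.q_pos a)).ne'
        (Real.exp_pos _).ne', Real.log_exp, sub_add_cancel]
  rw [h₁, h₂, sum_mul_exponent hp, Finset.sum_add_distrib, Finset.sum_sub_distrib, hp.1.2, hl.1.2]
  ring

theorem isExpParameters_iff {ρ : Fin k → ℝ} {l : ℝ × (Fin k → ℝ)} :
    K.IsExpParameters ρ l ↔ K.gibbs l ∈ K.feasible ρ := by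
  refine ⟨fun h => h.1, fun h => ⟨h, fun p hp => ?_⟩⟩
  have h₁ := divergence_sub_divergence_gibbs hp h
  have h₂ : 0 ≤ ∑ a, (p a * Real.log (p a / K.gibbs l a) - p a + K.gibbs l a) :=
    Finset.sum_nonneg fun a _ => gibbs_gap_nonneg (hp.1.1 a) (gibbs_pos l a)
  change K.divergence (K.gibbs l) ≤ K.divergence p
  linarith

theorem sum_obs (l : ℝ × (Fin k → ℝ)) (a : A) :
    ∑ j, (Fin.cons (1 + l.1) l.2 : Fin (k + 1) → ℝ) j * K.obs j a =
      1 + l.1 + ∑ i, l.2 i * K.r i a := by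
  simp [Fin.sum_univ_succ, obs]

/-- Taking logarithms recovers the exponent, and pairing it with the orthonormal functions r_0, …,
r_k recovers its coefficients. -/
theorem gibbs_injective (hK : K.Normalized) : Function.Injective K.gibbs := by
  intro l l' h
  have h₁ : (Fin.cons (1 + l.1) l.2 : Fin (k + 1) → ℝ) = Fin.cons (1 + l'.1) l'.2 := by
    ext j
    rw [← hK.expect_obs_mul_sum (Fin.cons (1 + l.1) l.2) j,
      ← hK.expect_obs_mul_sum (Fin.cons (1 + l'.1) l'.2) j]
    congr 1
    ext a
    have := Real.exp_injective (mul_left_cancel₀ (K.q_pos a).ne' (congrFun h a))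
    rw [sum_obs, sum_obs]
    congr 1
    linarith
  obtain ⟨h₂, h₃⟩ := Fin.cons_inj.1 h₁
  exact Prod.ext (by linarith) h₃

theorem IsExpParameters.unique (hK : K.Normalized) {ρ : Fin k → ℝ} {l l' : ℝ × (Fin k → ℝ)}
    (h : K.IsExpParameters ρ l) (h' : K.IsExpParameters ρ l') : l = l' := by
  refine gibbs_injective hK (funext fun a => ?_)
  have h₁ := divergence_sub_divergence_gibbs h.1 (isExpParameters_iff.1 h')
  have h₂ : K.divergence (K.gibbs l) ≤ K.divergence (K.gibbs l') := h.2 h'.1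
  have h₃ : K.divergence (K.gibbs l') ≤ K.divergence (K.gibbs l) := h'.2 h.1
  have h₄ := le_antisymm h₂ h₃
  change K.divergence (K.gibbs l) - _ = _ at h₁
  rw [h₄, sub_self] at h₁
  exact eq_of_gibbs_gap_eq_zero (gibbs_pos l a) (gibbs_pos l' a)
    ((Finset.sum_eq_zero_iff_of_nonneg fun a _ =>
      gibbs_gap_nonneg (gibbs_pos l a).le (gibbs_pos l' a)).1 h₁.symm a (Finset.mem_univ a))

theorem isExpParameters_treeSum (hK : K.Normalized) {ρ : Fin k → ℝ}
    (h : Summable fun T => ‖K.weight (-ρ) T‖) :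
    K.IsExpParameters ρ (K.treeSum (-ρ) 0 - 1, fun i => K.treeSum (-ρ) i.succ) := by
  set y := K.treeSum (-ρ) with hy
  set l : ℝ × (Fin k → ℝ) := (y 0 - 1, fun i => y i.succ) with hl
  have hyl : (Fin.cons (1 + l.1) l.2 : Fin (k + 1) → ℝ) = y := by
    ext j
    refine Fin.cases ?_ (fun i => ?_) j <;> simp [hl]
  have hg : ∀ a, K.gibbs l a = K.q a * Real.exp (-∑ j, y j * K.obs j a) := fun a => by
    rw [← hyl, sum_obs, gibbs]
    congr 2
    ring
  -- By orthonormality the linear part of the fixed-point equation is y_j itself; it cancels and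
  -- leaves the moment equation.
  have hmom : ∀ j, expect (K.gibbs l) (K.obs j) =
      (if j = 0 then 1 else 0) - ∑ i : Fin k, if i.succ = j then (-ρ) i else 0 := fun j => by
    have h₁ := K.treeSum_eq h j
    have h₂ := hK.expect_obs_mul_sum y j
    have h₃ := hK.expect_obs_mul_obs j 0
    have h₄ : expect K.q (fun a => K.obs j a * (Real.exp (-∑ j, y j * K.obs j a) - 1 +
        ∑ j, y j * K.obs j a)) = expect (K.gibbs l) (K.obs j) -
        expect K.q (fun a => K.obs j a * K.obs 0 a) +
        expect K.q (fun a => K.obs j a * ∑ j, y j * K.obs j a) := by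
      simp only [expect, ← Finset.sum_sub_distrib, ← Finset.sum_add_distrib, hg]
      refine Finset.sum_congr rfl fun a _ => ?_
      have : K.obs 0 a = 1 := rfl
      rw [this]
      ring
    rw [← hy, h₄, h₂, h₃] at h₁
    linarith
  refine isExpParameters_iff.2 ⟨⟨fun a => (gibbs_pos l a).le, ?_⟩, fun i => ?_⟩
  · have := hmom 0
    simpa [expect, obs, Fin.succ_ne_zero] using this
  · have := hmom i.succ
    simpa [obs, Fin.succ_ne_zero] using this

end KLProblem

/-! ### Rooted trees described by parent maps -/

namespace SimpleGraph

/-- `par` sends every vertex other than `o` to a neighbour, its parent, in such a way that all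
edges arise like this; the parent is closer to `o`, as measured by `δ`. -/
structure IsParentMap {V : Type*} (G : SimpleGraph V) (o : V) (par : V → V) (δ : V → ℕ) :
    Prop where
  adj_iff : ∀ v w, G.Adj v w ↔ (v ≠ o ∧ par v = w) ∨ (w ≠ o ∧ par w = v)
  lt : ∀ v, v ≠ o → δ (par v) < δ v

namespace IsParentMap

variable {V W : Type*} {G : SimpleGraph V} {H : SimpleGraph W} {o : V} {o' : W} {par : V → V}
  {par' : W → W} {δ : V → ℕ} {δ' : W → ℕ}

theorem par_par_ne (h : G.IsParentMap o par δ) {v : V} (hv : v ≠ o) (hpv : par v ≠ o) :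
    par (par v) ≠ v := fun he => by
  have h₁ := h.lt v hv
  have h₂ := h.lt _ hpv
  rw [he] at h₂
  exact lt_asymm h₁ h₂

theorem edge_injOn (h : G.IsParentMap o par δ) :
    Set.InjOn (fun v => s(v, par v)) {v | v ≠ o} := fun v hv w hw he => by
  rcases Sym2.eq_iff.1 he with h₁ | ⟨h₁, h₂⟩
  · exact h₁.1
  · exact absurd (by rw [h₂, h₁]) (h.par_par_ne hv (by rwa [h₂]))

theorem image_edge (h : G.IsParentMap o par δ) :
    (fun v => s(v, par v)) '' {v | v ≠ o} = G.edgeSet := by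
  ext e
  induction e using Sym2.ind with
  | _ v w =>
    rw [mem_edgeSet, h.adj_iff]
    constructor
    · rintro ⟨u, hu, he⟩
      rcases Sym2.eq_iff.1 he with ⟨rfl, rfl⟩ | ⟨rfl, rfl⟩
      · exact Or.inl ⟨hu, rfl⟩
      · exact Or.inr ⟨hu, rfl⟩
    · rintro (⟨hv, rfl⟩ | ⟨hw, rfl⟩)
      · exact ⟨v, hv, rfl⟩
      · exact ⟨w, hw, Sym2.eq_swap⟩

theorem reachable (h : G.IsParentMap o par δ) (v : V) : G.Reachable v o := by
  induction hn : δ v using Nat.strong_induction_on generalizing v with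
  | _ n ih =>
    subst hn
    by_cases hv : v = o
    · rw [hv]
    · exact ((h.adj_iff v _).2 (Or.inl ⟨hv, rfl⟩)).reachable.trans (ih _ (h.lt v hv) _ rfl)

/-- Following parents connects every vertex to the root, and the edges correspond to the vertices
other than the root, so there is one edge fewer than vertices. -/
theorem isTree [Finite V] (h : G.IsParentMap o par δ) : G.IsTree := by
  rw [isTree_iff_connected_and_card]
  have : Nonempty V := ⟨o⟩
  refine ⟨⟨fun v w => (h.reachable v).trans (h.reachable w).symm⟩, ?_⟩
  have h₁ : G.edgeSet.ncard = {v | v ≠ o}.ncard := by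
    rw [← h.image_edge, h.edge_injOn.ncard_image]
  have h₂ := Set.ncard_add_ncard_compl {o}
  rw [Set.ncard_singleton] at h₂
  rw [Nat.card_coe_set_eq, h₁, ← h₂, add_comm]
  rfl

/-- Otherwise the edge from φ v to φ (par v) would make φ v the parent of φ (par v). By induction
towards the root that parent is φ (par (par v)), and par (par v) ≠ v. -/
theorem map (h : G.IsParentMap o par δ) (h' : H.IsParentMap o' par' δ') (φ : G ≃g H)
    (ho : φ o = o') {v : V} (hv : v ≠ o) : par' (φ v) = φ (par v) := by
  induction hn : δ v using Nat.strong_induction_on generalizing v with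
  | _ n ih =>
    subst hn
    have hadj : H.Adj (φ v) (φ (par v)) :=
      φ.map_adj_iff.2 ((h.adj_iff v _).2 (Or.inl ⟨hv, rfl⟩))
    rcases (h'.adj_iff _ _).1 hadj with h₁ | ⟨h₁, h₂⟩
    · exact h₁.2
    · have hpv : par v ≠ o := fun he => h₁ (by rw [he, ho])
      rw [ih _ (h.lt v hv) hpv rfl] at h₂
      exact absurd (φ.injective h₂) (h.par_par_ne hv hpv)

theorem map_adj_iff (h : G.IsParentMap o par δ) (h' : H.IsParentMap o' par' δ') (φ : V ≃ W)
    (ho : φ o = o') (hφ : ∀ v, v ≠ o → par' (φ v) = φ (par v)) {v w : V} :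
    H.Adj (φ v) (φ w) ↔ G.Adj v w := by
  have key : ∀ v w, (φ v ≠ o' ∧ par' (φ v) = φ w) ↔ (v ≠ o ∧ par v = w) := fun v w => by
    rw [← ho, φ.injective.ne_iff]
    refine and_congr_right fun hv => ?_
    rw [hφ v hv, φ.injective.eq_iff]
  rw [h.adj_iff, h'.adj_iff, key, key]

end IsParentMap

/-- The parent is the next vertex on a geodesic to `o`. Acyclicity enters only through the number of
edges: v ↦ {v, par v} is injective on the vertices other than `o`, and the tree has just as many
edges, so none is missed. -/
theorem IsTree.exists_isParentMap {V : Type*} [Finite V] {G : SimpleGraph V} (hG : G.IsTree)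
    (o : V) : ∃ par δ, G.IsParentMap o par δ := by
  have hex : ∀ v, ∃ w, v ≠ o → G.Adj v w ∧ G.dist o w < G.dist o v := fun v => by
    by_cases hv : v = o
    · exact ⟨v, fun h => absurd hv h⟩
    · obtain ⟨p, hp⟩ := hG.connected.exists_walk_length_eq_dist v o
      cases p with
      | nil => exact absurd rfl hv
      | @cons _ w _ hvw q =>
        refine ⟨w, fun _ => ⟨hvw, ?_⟩⟩
        have := dist_le q
        rw [Walk.length_cons] at hp
        rw [dist_comm, dist_comm (u := o)]
        omega
  choose par hpar using hex
  refine ⟨par, fun v => G.dist o v, ?_, fun v hv => (hpar v hv).2⟩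
  have hinj : Set.InjOn (fun v => s(v, par v)) {v | v ≠ o} := fun v hv w hw he => by
    rcases Sym2.eq_iff.1 he with h₁ | ⟨h₁, h₂⟩
    · exact h₁.1
    · have h₃ := (hpar v hv).2
      have h₄ := (hpar w hw).2
      rw [← h₁] at h₄
      rw [h₂] at h₃
      exact absurd h₃ (lt_asymm h₄)
  have hsub : (fun v => s(v, par v)) '' {v | v ≠ o} ⊆ G.edgeSet := by
    rintro _ ⟨v, hv, rfl⟩
    exact (hpar v hv).1
  have himg : (fun v => s(v, par v)) '' {v | v ≠ o} = G.edgeSet := by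
    refine Set.eq_of_subset_of_ncard_le hsub ?_ (Set.toFinite _)
    have h₁ := (isTree_iff_connected_and_card.1 hG).2
    have h₂ := Set.ncard_add_ncard_compl {o}
    rw [Set.ncard_singleton, ← h₁, add_comm, Nat.card_coe_set_eq] at h₂
    rw [hinj.ncard_image]
    exact (Nat.succ_injective h₂).ge
  intro v w
  constructor
  · intro hvw
    rw [← mem_edgeSet, ← himg] at hvw
    obtain ⟨u, hu, he⟩ := hvw
    rcases Sym2.eq_iff.1 he with ⟨rfl, rfl⟩ | ⟨rfl, rfl⟩
    · exact Or.inl ⟨hu, rfl⟩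
    · exact Or.inr ⟨hu, rfl⟩
  · rintro (⟨hv, rfl⟩ | ⟨hw, rfl⟩)
    · exact (hpar v hv).1
    · exact (hpar w hw).1.symm

end SimpleGraph

/-! ### Orderings of finite sets and vertices of planar trees -/

theorem Set.bijOn_image_iff {α β γ : Type*} {f : β → γ} {g : α → β} {s : Set α} {t : Set γ}
    (hg : Function.Injective g) : Set.BijOn f (g '' s) t ↔ Set.BijOn (f ∘ g) s t := by
  constructor
  · exact fun h => h.comp hg.injOn.bijOn_image
  · intro h
    refine ⟨?_, ?_, ?_⟩
    · rintro _ ⟨x, hx, rfl⟩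
      exact h.mapsTo hx
    · rintro _ ⟨x, hx, rfl⟩ _ ⟨y, hy, rfl⟩ he
      rw [h.injOn hx hy he]
    · intro z hz
      obtain ⟨x, hx, rfl⟩ := h.surjOn hz
      exact ⟨g x, ⟨x, hx, rfl⟩, rfl⟩

theorem Nat.card_bijOn_univ {V : Type*} [Finite V] {n : ℕ} {s : Set V} (hs : s.ncard = n) :
    Nat.card {e : Fin n → V // Set.BijOn e Set.univ s} = n.factorial := by
  classical
  have := Fintype.ofFinite s
  have hc : Fintype.card s = n := by rw [← Nat.card_eq_fintype_card, Nat.card_coe_set_eq, hs]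
  let E : {e : Fin n → V // Set.BijOn e Set.univ s} ≃ (Fin n ≃ s) :=
    { toFun := fun e => Equiv.ofBijective (fun i => ⟨e.1 i, e.2.mapsTo (Set.mem_univ i)⟩)
        ⟨fun i j h => e.2.injOn (Set.mem_univ i) (Set.mem_univ j) (congrArg Subtype.val h),
          fun w => by
            obtain ⟨i, -, hi⟩ := e.2.surjOn w.2
            exact ⟨i, Subtype.ext hi⟩⟩
      invFun := fun e => ⟨fun i => e i, fun i _ => (e i).2,
        fun i _ j _ h => e.injective (Subtype.ext h),
        fun w hw => ⟨e.symm ⟨w, hw⟩, Set.mem_univ _, by simp⟩⟩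
      left_inv := fun e => rfl
      right_inv := fun e => by ext; rfl }
  rw [Nat.card_congr E, Nat.card_eq_fintype_card,
    Fintype.card_equiv (Fintype.equivFinOfCardEq hc).symm, Fintype.card_fin]

namespace PlanarTree

variable {k : ℕ}

/-- The vertices of a planar tree: the lower ends of its edges. -/
def Vert : PlanarTree k → Type
  | leaf _ => Unit
  | node _ _ c => Option (Σ i, Vert (c i))

instance instFintypeVert : (T : PlanarTree k) → Fintype T.Vert
  | leaf _ => inferInstanceAs (Fintype Unit)
  | node _ _ c =>
    haveI := fun i => instFintypeVert (c i)
    inferInstanceAs (Fintype (Option (Σ i, Vert (c i))))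

def root : (T : PlanarTree k) → T.Vert
  | leaf _ => ()
  | node _ _ _ => none

/-- The vertex of a node that comes from a vertex of its `i`-th child. -/
def inner {l : Fin (k + 1)} {d : ℕ} {c : Fin (d + 2) → PlanarTree k} (i : Fin (d + 2))
    (u : (c i).Vert) : (node l d c).Vert :=
  some (⟨i, u⟩ : Σ i, (c i).Vert)

theorem inner_eq_inner {l : Fin (k + 1)} {d : ℕ} {c : Fin (d + 2) → PlanarTree k}
    {i j : Fin (d + 2)} {u : (c i).Vert} {v : (c j).Vert}
    (h : inner (l := l) i u = inner (l := l) j v) :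
    (⟨i, u⟩ : Σ i, (c i).Vert) = ⟨j, v⟩ :=
  Option.some_injective (Σ i, (c i).Vert) h

theorem inner_injective {l : Fin (k + 1)} {d : ℕ} {c : Fin (d + 2) → PlanarTree k}
    (i : Fin (d + 2)) : Function.Injective (inner (l := l) (c := c) i) := fun _ _ h =>
  sigma_mk_injective (β := fun i => (c i).Vert) (inner_eq_inner h)

theorem inner_ne_root {l : Fin (k + 1)} {d : ℕ} {c : Fin (d + 2) → PlanarTree k}
    {i : Fin (d + 2)} (u : (c i).Vert) : inner i u ≠ (node l d c).root :=
  Option.some_ne_none (α := Σ i, (c i).Vert) _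

@[elab_as_elim]
theorem node_cases {l : Fin (k + 1)} {d : ℕ} {c : Fin (d + 2) → PlanarTree k}
    {P : (node l d c).Vert → Prop} (root : P (node l d c).root) (inner : ∀ i u, P (inner i u))
    (u : (node l d c).Vert) : P u :=
  match u with
  | none => root
  | some ⟨i, u⟩ => inner i u

/-- The outer `none` means that there is no parent. For the root of a child, the recursive value
`none` becomes `some none`, whose inner `none` is the root of the node. -/
def parent : (T : PlanarTree k) → T.Vert → Option T.Vert
  | leaf _, _ => none
  | node _ _ _, none => none
  | node _ _ c, some ⟨i, u⟩ => some ((parent (c i) u).map (Sigma.mk i))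

/-- The label of the edge above a vertex. -/
def vertLab : (T : PlanarTree k) → T.Vert → Fin (k + 1)
  | leaf i, _ => i.succ
  | node l _ _, none => l
  | node _ _ c, some ⟨i, u⟩ => vertLab (c i) u

def depth : (T : PlanarTree k) → T.Vert → ℕ
  | leaf _, _ => 0
  | node _ _ _, none => 0
  | node _ _ c, some ⟨i, u⟩ => depth (c i) u + 1

/-- The children of a vertex. -/
def childSet (T : PlanarTree k) (u : T.Vert) : Set T.Vert := {u' | T.parent u' = some u}

theorem vertLab_root (T : PlanarTree k) : T.vertLab T.root = T.lab := by
  cases T <;> rfl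

theorem parent_eq_none_iff (T : PlanarTree k) (u : T.Vert) : T.parent u = none ↔ u = T.root := by
  cases T with
  | leaf i => exact ⟨fun _ => rfl, fun _ => rfl⟩
  | node l d c =>
    induction u using node_cases with
    | root => exact ⟨fun _ => rfl, fun _ => rfl⟩
    | inner i u =>
      exact ⟨fun h => absurd h (Option.some_ne_none _), fun h => absurd h (inner_ne_root u)⟩

variable {l : Fin (k + 1)} {d : ℕ} {c : Fin (d + 2) → PlanarTree k}

theorem parent_inner_eq_root {i : Fin (d + 2)} {u : (c i).Vert} :
    (node l d c).parent (inner i u) = some (node l d c).root ↔ u = (c i).root := by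
  rw [← parent_eq_none_iff]
  change some (((c i).parent u).map (Sigma.mk (β := fun i => (c i).Vert) i)) = some none ↔ _
  simp

theorem parent_inner_eq_inner {i j : Fin (d + 2)} {u : (c i).Vert} {v : (c j).Vert} :
    (node l d c).parent (inner i u) = some (inner j v) ↔
      ∃ w, (c i).parent u = some w ∧ (⟨i, w⟩ : Σ i, (c i).Vert) = ⟨j, v⟩ := by
  change some (((c i).parent u).map (Sigma.mk (β := fun i => (c i).Vert) i)) = some (some _) ↔ _
  rw [Option.some_inj, Option.map_eq_some_iff]

theorem depth_lt (T : PlanarTree k) {u v : T.Vert} (h : T.parent u = some v) :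
    T.depth v < T.depth u := by
  induction T with
  | leaf i => exact absurd h (Option.some_ne_none _).symm
  | node l d c ih =>
    induction u using node_cases with
    | root => exact absurd h (Option.some_ne_none _).symm
    | inner i u =>
      induction v using node_cases with
      | root => exact Nat.succ_pos _
      | inner j v =>
        obtain ⟨w, hw, he⟩ := parent_inner_eq_inner.1 h
        cases he
        exact Nat.succ_lt_succ (ih i hw)

theorem childSet_leaf (i : Fin k) (u : (leaf i).Vert) : (leaf i).childSet u = ∅ :=
  Set.eq_empty_of_forall_notMem fun _ h => (Option.some_ne_none _).symm h

theorem childSet_node_root :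
    (node l d c).childSet (node l d c).root = Set.range fun i => inner i (c i).root := by
  ext u
  induction u using node_cases with
  | root =>
    refine ⟨fun h => absurd h (Option.some_ne_none _).symm, ?_⟩
    rintro ⟨i, h⟩
    exact absurd h (inner_ne_root _)
  | inner i u =>
    refine parent_inner_eq_root.trans ⟨?_, ?_⟩
    · rintro rfl
      exact ⟨i, rfl⟩
    · rintro ⟨j, h⟩
      cases inner_eq_inner h
      rfl

theorem childSet_node_inner (i : Fin (d + 2)) (u : (c i).Vert) :
    (node l d c).childSet (inner i u) = inner i '' (c i).childSet u := by
  ext v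
  induction v using node_cases with
  | root =>
    refine ⟨fun h => absurd h (Option.some_ne_none _).symm, ?_⟩
    rintro ⟨w, -, h⟩
    exact absurd h (inner_ne_root _)
  | inner j v =>
    refine parent_inner_eq_inner.trans ⟨?_, ?_⟩
    · rintro ⟨w, hw, h⟩
      cases h
      exact ⟨v, hw, rfl⟩
    · rintro ⟨w, hw, h⟩
      cases inner_eq_inner h
      exact ⟨u, hw, rfl⟩

theorem inner_root_injective :
    Function.Injective fun i => inner (l := l) (c := c) i (c i).root := fun _ _ h =>
  congrArg Sigma.fst (inner_eq_inner h)

end PlanarTree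

/-! ### Planar charts and their weighted number -/

namespace PlanarTree

variable {k : ℕ}

/-- The product of the factorials of the numbers of children of the nodes. -/
def symmetry : PlanarTree k → ℕ
  | leaf _ => 1
  | node _ d c => (d + 2).factorial * ∏ i, symmetry (c i)

variable {V : Type*}

/-- `f` identifies the planar tree `T` with the part below `v` of a rooted tree with vertex set
`V`, given by the sets of children and the labels of the edges above the vertices. -/
structure IsPlanarChart (ch : V → Set V) (up : V → Fin (k + 1)) (T : PlanarTree k) (v : V)
    (f : T.Vert → V) : Prop where
  root : f T.root = v
  lab : ∀ u, up (f u) = T.vertLab u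
  bijOn : ∀ u, Set.BijOn f (T.childSet u) (ch (f u))

/-- The planar charts of the part below `v` with values in a given planar tree. -/
abbrev Chart (ch : V → Set V) (up : V → Fin (k + 1)) (T : PlanarTree k) (v : V) : Type _ :=
  {f : T.Vert → V // IsPlanarChart ch up T v f}

variable {ch : V → Set V} {up : V → Fin (k + 1)}

theorem isPlanarChart_leaf {i : Fin k} {v : V} {f : (leaf i).Vert → V} :
    IsPlanarChart ch up (leaf i) v f ↔ f = (fun _ => v) ∧ up v = i.succ ∧ ch v = ∅ := by
  constructor
  · intro h
    have h₀ : f = fun _ => v := funext fun u => h.root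
    subst h₀
    refine ⟨rfl, h.lab (leaf i).root, ?_⟩
    have := (h.bijOn (leaf i).root).image_eq
    rw [childSet_leaf, Set.image_empty] at this
    exact this.symm
  · rintro ⟨rfl, h₁, h₂⟩
    refine ⟨rfl, fun _ => h₁, fun u => ?_⟩
    rw [childSet_leaf]
    rw [h₂]
    exact Set.bijOn_empty _

theorem isPlanarChart_node {l : Fin (k + 1)} {d : ℕ} {c : Fin (d + 2) → PlanarTree k} {v : V}
    {f : (node l d c).Vert → V} :
    IsPlanarChart ch up (node l d c) v f ↔ f (node l d c).root = v ∧ up v = l ∧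
      Set.BijOn (fun i => f (inner i (c i).root)) Set.univ (ch v) ∧
      ∀ i, IsPlanarChart ch up (c i) (f (inner i (c i).root)) (fun u => f (inner i u)) := by
  constructor
  · intro h
    refine ⟨h.root, ?_, ?_, fun i => ⟨rfl, fun u => h.lab (inner i u), fun u => ?_⟩⟩
    · rw [← h.root]
      exact h.lab (node l d c).root
    · have := h.bijOn (node l d c).root
      rw [h.root, childSet_node_root, ← Set.image_univ,
        Set.bijOn_image_iff inner_root_injective] at this
      exact this
    · have := h.bijOn (inner i u)
      rw [childSet_node_inner, Set.bijOn_image_iff (inner_injective i)] at this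
      exact this
  · rintro ⟨h₁, h₂, h₃, h₄⟩
    refine ⟨h₁, fun u => ?_, fun u => ?_⟩
    · induction u using node_cases with
      | root => rw [h₁, h₂]; rfl
      | inner i u => exact (h₄ i).lab u
    · induction u using node_cases with
      | root =>
        rw [h₁, childSet_node_root, ← Set.image_univ, Set.bijOn_image_iff inner_root_injective]
        exact h₃
      | inner i u =>
        rw [childSet_node_inner, Set.bijOn_image_iff (inner_injective i)]
        exact (h₄ i).bijOn u

theorem card_chart_leaf (i : Fin k) (v : V) [Decidable (up v = i.succ ∧ ch v = ∅)] :
    Nat.card (Chart ch up (leaf i) v) = if up v = i.succ ∧ ch v = ∅ then 1 else 0 := by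
  split_ifs with h
  · have : Unique (Chart ch up (leaf i) v) :=
      { default := ⟨fun _ => v, isPlanarChart_leaf.2 ⟨rfl, h⟩⟩
        uniq := fun f => Subtype.ext (isPlanarChart_leaf.1 f.2).1 }
    exact Nat.card_unique
  · have : IsEmpty (Chart ch up (leaf i) v) := ⟨fun f => h (isPlanarChart_leaf.1 f.2).2⟩
    exact Nat.card_of_isEmpty

/-- A chart with values in a node consists of an ordering of the children and of charts below
them. -/
def chartNodeEquiv (l : Fin (k + 1)) (d : ℕ) (c : Fin (d + 2) → PlanarTree k) {v : V}
    (hv : up v = l) :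
    Chart ch up (node l d c) v ≃
      Σ e : {e : Fin (d + 2) → V // Set.BijOn e Set.univ (ch v)}, ∀ i, Chart ch up (c i) (e.1 i) where
  toFun f := ⟨⟨fun i => f.1 (inner i (c i).root), (isPlanarChart_node.1 f.2).2.2.1⟩,
    fun i => ⟨fun u => f.1 (inner i u), (isPlanarChart_node.1 f.2).2.2.2 i⟩⟩
  invFun x := ⟨fun u => match u with
      | none => v
      | some ⟨i, u⟩ => (x.2 i).1 u,
    isPlanarChart_node.2 ⟨rfl, hv, by
      convert x.1.2 using 2 with i
      exact (x.2 i).2.root, fun i => by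
      have h := (x.2 i).2
      refine ⟨rfl, h.lab, h.bijOn⟩⟩⟩
  left_inv f := by
    refine Subtype.ext (funext fun u => ?_)
    induction u using node_cases with
    | root => exact (isPlanarChart_node.1 f.2).1.symm
    | inner i u => rfl
  right_inv := by
    rintro ⟨⟨e, he⟩, g⟩
    -- Separating the functions from their proofs allows `e` to be replaced by the root values of
    -- the charts, after which both sides agree definitionally.
    obtain ⟨f, hf, rfl⟩ : ∃ (f : ∀ i, (c i).Vert → V)
        (hf : ∀ i, IsPlanarChart ch up (c i) (e i) (f i)), g = fun i => ⟨f i, hf i⟩ :=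
      ⟨fun i => (g i).1, fun i => (g i).2, rfl⟩
    obtain rfl : e = fun i => f i (c i).root := funext fun i => (hf i).root.symm
    rfl

theorem card_chart_node [Finite V] (l : Fin (k + 1)) (d : ℕ) (c : Fin (d + 2) → PlanarTree k)
    {v : V} [Fintype {e : Fin (d + 2) → V // Set.BijOn e Set.univ (ch v)}] (hv : up v = l) :
    Nat.card (Chart ch up (node l d c) v) =
      ∑ e : {e : Fin (d + 2) → V // Set.BijOn e Set.univ (ch v)},
        ∏ i, Nat.card (Chart ch up (c i) (e.1 i)) := by
  rw [Nat.card_congr (chartNodeEquiv l d c hv), Nat.card_sigma]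
  simp only [Nat.card_pi]

/-- Every rooted tree without vertices with exactly one child has, counted with the
appropriate weights, exactly one planar chart. -/
theorem hasSum_card_chart [Finite V] (δ : V → ℕ) (good : Set V)
    (hδ : ∀ v ∈ good, ∀ w ∈ ch v, w ∈ good ∧ δ v < δ w)
    (hgood : ∀ v ∈ good, (ch v = ∅ ∧ up v ≠ 0) ∨ 2 ≤ (ch v).ncard) (v : V) (hv : v ∈ good) :
    HasSum (fun T : PlanarTree k => (Nat.card (Chart ch up T v) : ℝ) / T.symmetry) 1 := by
  classical
  have := Fintype.ofFinite V
  -- δ grows towards the children, so this difference drops.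
  induction hn : (Finset.univ.sup δ - δ v) using Nat.strong_induction_on generalizing v with
  | _ n ih =>
    subst hn
    have ih' : ∀ w ∈ ch v, HasSum (fun T : PlanarTree k =>
        (Nat.card (Chart ch up T w) : ℝ) / T.symmetry) 1 := fun w hw => by
      obtain ⟨hw₁, hw₂⟩ := hδ v hv w hw
      refine ih _ ?_ w hw₁ rfl
      have := Finset.le_sup (f := δ) (Finset.mem_univ w)
      omega
    rcases hgood v hv with ⟨h₁, h₂⟩ | h₁
    · obtain ⟨i, hi⟩ := Fin.exists_succ_eq.2 h₂
      -- At a vertex without children only the leaf with the right label has a chart; the chart is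
      -- unique.
      convert hasSum_ite_eq (leaf i) (1 : ℝ) using 2 with T
      cases T with
      | leaf i' =>
        rw [card_chart_leaf, symmetry]
        simp only [h₁, ← hi, leaf.injEq, and_true, Fin.succ_inj, eq_comm (a := i)]
        split_ifs <;> simp
      | node l d c =>
        have : IsEmpty (Chart ch up (node l d c) v) := ⟨fun f => by
          have := (isPlanarChart_node.1 f.2).2.2.1.mapsTo (Set.mem_univ 0)
          rw [h₁] at this
          exact this⟩
        simp
    · obtain ⟨d, hd⟩ := Nat.exists_eq_add_of_le' h₁
      have hinj : Function.Injective fun c : Fin (d + 2) → PlanarTree k => node (up v) d c :=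
        fun c c' h => by simpa using h
      refine (hinj.hasSum_iff fun T hT => ?_).1 ?_
      · suffices IsEmpty (Chart ch up T v) by simp
        refine ⟨fun f => ?_⟩
        cases T with
        | leaf i =>
          rw [(isPlanarChart_leaf.1 f.2).2.2, Set.ncard_empty] at hd
          omega
        | node l d' c =>
          obtain ⟨-, h₂, h₃, -⟩ := isPlanarChart_node.1 f.2
          have h₄ := h₃.injOn.ncard_image
          rw [h₃.image_eq, Set.ncard_univ, Nat.card_eq_fintype_card, Fintype.card_fin, hd] at h₄
          obtain rfl : d = d' := by omega
          exact hT ⟨c, by rw [h₂]⟩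
      · have hpi : ∀ e : {e : Fin (d + 2) → V // Set.BijOn e Set.univ (ch v)},
            HasSum (fun c : Fin (d + 2) → PlanarTree k =>
              ∏ i, ((Nat.card (Chart ch up (c i) (e.1 i)) : ℝ) / (c i).symmetry)) 1 := fun e => by
          have hi : ∀ i, HasSum (fun T : PlanarTree k =>
            (Nat.card (Chart ch up T (e.1 i)) : ℝ) / T.symmetry) 1 :=
              fun i => ih' _ (e.2.mapsTo (Set.mem_univ i))
          have := (summable_norm_and_hasSum_pi_prod (fun i (T : PlanarTree k) =>
            (Nat.card (Chart ch up T (e.1 i)) : ℝ) / T.symmetry) fun i => (hi i).summable.abs).2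
          simpa only [(hi _).tsum_eq, Finset.prod_const_one] using this
        -- Each of the (d + 2)! orderings of the children contributes 1, by induction below every
        -- child; the factor (d + 2)! in `symmetry` compensates for their number.
        have hsum := (hasSum_sum (s := Finset.univ) fun e _ => hpi e).mul_left
          (1 / ((d + 2).factorial : ℝ))
        have hcard : (Finset.univ : Finset {e : Fin (d + 2) → V //
            Set.BijOn e Set.univ (ch v)}).card = (d + 2).factorial := by
          rw [Finset.card_univ, ← Nat.card_eq_fintype_card, Nat.card_bijOn_univ hd]
        have hone : 1 / ((d + 2).factorial : ℝ) * ∑ e : {e : Fin (d + 2) → V //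
            Set.BijOn e Set.univ (ch v)}, (1 : ℝ) = 1 := by
          rw [Finset.sum_const, hcard, nsmul_eq_mul, mul_one, one_div,
            inv_mul_cancel₀ (Nat.cast_ne_zero.2 (Nat.factorial_ne_zero _))]
        rw [hone] at hsum
        have heq : ((fun T : PlanarTree k => (Nat.card (Chart ch up T v) : ℝ) / T.symmetry) ∘
            fun c : Fin (d + 2) → PlanarTree k => node (up v) d c) = fun c =>
            1 / ((d + 2).factorial : ℝ) * ∑ e : {e : Fin (d + 2) → V //
              Set.BijOn e Set.univ (ch v)},
              ∏ i, ((Nat.card (Chart ch up (c i) (e.1 i)) : ℝ) / (c i).symmetry) := by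
          ext c
          rw [Function.comp_apply, card_chart_node _ d c rfl, symmetry]
          push_cast
          simp only [Finset.prod_div_distrib]
          rw [← Finset.sum_div, div_mul_div_comm, one_mul]
        rw [heq]
        exact hsum

end PlanarTree

/-! ### Moment trees as rooted trees, and their isomorphisms -/

namespace SimpleGraph.IsParentMap

variable {V : Type*} {G : SimpleGraph V} {o : V} {par : V → V} {δ : V → ℕ}

theorem neighborSet_root (h : G.IsParentMap o par δ) :
    G.neighborSet o = {w | w ≠ o ∧ par w = o} := by
  ext w
  rw [mem_neighborSet, h.adj_iff]
  simp

theorem neighborSet_eq_insert (h : G.IsParentMap o par δ) {v : V} (hv : v ≠ o) :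
    G.neighborSet v = insert (par v) {w | w ≠ o ∧ par w = v} := by
  ext w
  rw [mem_neighborSet, h.adj_iff]
  simp [hv, eq_comm]

theorem par_notMem (h : G.IsParentMap o par δ) {v : V} (hv : v ≠ o) :
    par v ∉ {w | w ≠ o ∧ par w = v} :=
  fun hp => h.par_par_ne hv hp.1 hp.2

theorem ncard_neighborSet [Finite V] (h : G.IsParentMap o par δ) {v : V} (hv : v ≠ o) :
    (G.neighborSet v).ncard = {w | w ≠ o ∧ par w = v}.ncard + 1 := by
  rw [h.neighborSet_eq_insert hv, Set.ncard_insert_of_notMem (h.par_notMem hv)]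

end SimpleGraph.IsParentMap

namespace MomentTree

variable {k : ℕ} {V W : Type*} [Fintype V] [Fintype W] (Γ : MomentTree k V)

/-- The neighbour of a vertex on the way to the distinguished leaf. -/
noncomputable def par : V → V := (Γ.isTree.exists_isParentMap Γ.out).choose

theorem exists_isParentMap : ∃ δ, Γ.graph.IsParentMap Γ.out Γ.par δ :=
  (Γ.isTree.exists_isParentMap Γ.out).choose_spec

def children (v : V) : Set V := {w | w ≠ Γ.out ∧ Γ.par w = v}

/-- The label of the edge from a vertex to its parent. -/
noncomputable def up (v : V) : Fin (k + 1) := Γ.label s(v, Γ.par v)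

variable {Γ}

theorem deg_eq {v : V} (hv : v ≠ Γ.out) : Γ.deg v = (Γ.children v).ncard + 1 := by
  obtain ⟨δ, h⟩ := Γ.exists_isParentMap
  exact h.ncard_neighborSet hv

theorem deg_eq_one_iff {v : V} (hv : v ≠ Γ.out) : Γ.deg v = 1 ↔ Γ.children v = ∅ := by
  rw [deg_eq hv, Nat.add_eq_right, Set.ncard_eq_zero]

theorem neighborSet_eq {v : V} (hv : v ≠ Γ.out) :
    Γ.graph.neighborSet v = insert (Γ.par v) (Γ.children v) := by
  obtain ⟨δ, h⟩ := Γ.exists_isParentMap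
  exact h.neighborSet_eq_insert hv

theorem par_notMem_children {v : V} (hv : v ≠ Γ.out) : Γ.par v ∉ Γ.children v := by
  obtain ⟨δ, h⟩ := Γ.exists_isParentMap
  exact h.par_notMem hv

theorem adj_par {v : V} (hv : v ≠ Γ.out) : Γ.graph.Adj v (Γ.par v) := by
  obtain ⟨δ, h⟩ := Γ.exists_isParentMap
  exact (h.adj_iff _ _).2 (Or.inl ⟨hv, rfl⟩)

theorem label_child {v w : V} (hw : w ∈ Γ.children v) : Γ.label s(v, w) = Γ.up w := by
  rw [up, hw.2, Sym2.eq_swap]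

theorem exists_children_out : ∃ t, Γ.children Γ.out = {t} := by
  obtain ⟨δ, h⟩ := Γ.exists_isParentMap
  have h₁ := Γ.out_leaf
  rw [h.neighborSet_root, Set.ncard_eq_one] at h₁
  exact h₁

theorem hasOutput_iff {t : V} (ht : Γ.children Γ.out = {t}) (j : Fin (k + 1)) :
    Γ.HasOutput j ↔ Γ.up t = j := by
  obtain ⟨δ, h⟩ := Γ.exists_isParentMap
  have ht' : t ∈ Γ.children Γ.out := by rw [ht]; rfl
  have hadj : ∀ w, Γ.graph.Adj Γ.out w ↔ w = t := fun w => by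
    rw [← SimpleGraph.mem_neighborSet, h.neighborSet_root]
    change w ∈ Γ.children Γ.out ↔ _
    rw [ht, Set.mem_singleton_iff]
  simp only [HasOutput, hadj, forall_eq, label_child ht']

theorem children_eq_empty_or {v : V} (hv : v ≠ Γ.out) :
    (Γ.children v = ∅ ∧ Γ.up v ≠ 0) ∨ 2 ≤ (Γ.children v).ncard := by
  by_cases h : Γ.deg v = 1
  · exact Or.inl ⟨(deg_eq_one_iff hv).1 h, Γ.leaf_label v _ hv h (adj_par hv)⟩
  · have h₁ : 3 ≤ Γ.deg v := Γ.valency v h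
    rw [deg_eq hv] at h₁
    exact Or.inr (by omega)

theorem leafIndex_eq_ncard (i : Fin k) :
    Γ.leafIndex i = {v | v ≠ Γ.out ∧ Γ.children v = ∅ ∧ Γ.up v = i.succ}.ncard := by
  rw [leafIndex]
  congr 1
  ext v
  refine and_congr_right fun hv => ?_
  rw [deg_eq_one_iff hv]
  refine and_congr_right fun h => ?_
  have hadj : ∀ w, Γ.graph.Adj v w ↔ w = Γ.par v := fun w => by
    rw [← SimpleGraph.mem_neighborSet, neighborSet_eq hv, h]
    simp
  simp only [hadj, exists_eq_left, up]

theorem coupling_eq {A : Type*} [Fintype A] (K : KLProblem A k) {v : V} (hv : v ≠ Γ.out) :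
    Γ.coupling K v = (-1) ^ (Γ.children v).ncard * KLProblem.expect K.q
      (fun a => K.obs (Γ.up v) a * ∏ᶠ w ∈ Γ.children v, K.obs (Γ.up w) a) := by
  classical
  -- The valency is one more than the number of children, so deg + 1 has the parity of that number.
  rw [coupling, deg_eq hv, add_assoc, pow_add, show ((-1 : ℝ)) ^ (1 + 1) = 1 by norm_num, mul_one]
  congr 2
  ext a
  rw [← finprod_mem_coe_finset]
  have h₁ : ((Finset.univ.filter (Γ.graph.Adj v) : Finset V) : Set V) =
      insert (Γ.par v) (Γ.children v) := by
    rw [← neighborSet_eq hv]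
    ext w
    simp
  have h₂ : ∏ᶠ w ∈ insert (Γ.par v) (Γ.children v), K.obs (Γ.label s(v, w)) a =
      K.obs (Γ.up v) a * ∏ᶠ w ∈ Γ.children v, K.obs (Γ.up w) a := by
    rw [finprod_mem_insert _ (par_notMem_children hv) (Set.toFinite _)]
    exact congrArg _ (finprod_mem_congr rfl fun w hw => by rw [label_child hw])
  rw [← h₂, ← h₁]

namespace Iso

variable {Δ : MomentTree k W}

theorem deg_apply (φ : Iso Γ Δ) (v : V) : Δ.deg (φ.1 v) = Γ.deg v :=
  (Nat.card_congr (φ.1.mapNeighborSet v)).symm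

theorem leafIndex_eq (φ : Iso Γ Δ) : Δ.leafIndex = Γ.leafIndex := by
  ext i
  rw [leafIndex, leafIndex, ← Set.ncard_image_of_injective _ φ.1.injective]
  congr 1
  ext w
  obtain ⟨v, rfl⟩ := φ.1.surjective w
  rw [φ.1.injective.mem_set_image]
  simp only [Set.mem_ofPred_eq, φ.deg_apply, ← φ.2.1, φ.1.injective.ne_iff]
  refine and_congr_right fun _ => and_congr_right fun _ => ?_
  rw [φ.1.surjective.exists]
  refine exists_congr fun w => ?_
  rw [φ.1.map_adj_iff]
  exact and_congr_right fun h => by rw [φ.2.2 _ _ h]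

theorem hasOutput {j : Fin (k + 1)} (φ : Iso Γ Δ) (h : Γ.HasOutput j) : Δ.HasOutput j := by
  obtain ⟨f, ho, hl⟩ := φ
  intro w hw
  obtain ⟨v, rfl⟩ := f.surjective w
  rw [← ho] at hw ⊢
  have hv := f.map_adj_iff.1 hw
  rw [hl _ _ hv, h v hv]

theorem coupling_apply {A : Type*} [Fintype A] (K : KLProblem A k) (φ : Iso Γ Δ) (v : V) :
    Δ.coupling K (φ.1 v) = Γ.coupling K v := by
  classical
  rw [coupling, coupling, φ.deg_apply]
  congr 2
  ext a
  refine (Finset.prod_equiv φ.1.toEquiv (fun w => ?_) fun w hw => ?_).symm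
  · simp only [Finset.mem_filter, Finset.mem_univ, true_and]
    exact φ.1.map_adj_iff.symm
  · rw [← φ.2.2 v w (Finset.mem_filter.1 hw).2]
    rfl

theorem amplitude_eq {A : Type*} [Fintype A] (K : KLProblem A k) (φ : Iso Γ Δ) :
    Δ.amplitude K = Γ.amplitude K := by
  classical
  rw [amplitude, amplitude]
  refine (Finset.prod_equiv φ.1.toEquiv (fun w => ?_) fun w _ => ?_).symm
  · simp only [Finset.mem_filter, Finset.mem_univ, true_and]
    exact (φ.deg_apply w).symm ▸ Iff.rfl
  · exact (φ.coupling_apply K w).symm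

/-- The isomorphisms form a torsor under the automorphisms. -/
theorem card_eq_card_aut (φ : Iso Γ Δ) : Nat.card (Iso Γ Δ) = Nat.card Δ.Aut :=
  Nat.card_congr
    { toFun := fun ψ => φ.symm.trans ψ
      invFun := fun σ => φ.trans σ
      left_inv := fun ψ => Subtype.ext (RelIso.ext fun v => by
        change ψ.1 (φ.1.symm (φ.1 v)) = ψ.1 v
        rw [RelIso.symm_apply_apply])
      right_inv := fun σ => Subtype.ext (RelIso.ext fun v => by
        change σ.1 (φ.1 (φ.1.symm v)) = σ.1 v
        rw [RelIso.apply_symm_apply]) }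

instance finite : Finite (Iso Γ Δ) := by
  refine Finite.of_injective (fun φ : Iso Γ Δ => (φ.1 : V → W)) fun φ ψ h =>
    Subtype.ext (RelIso.ext fun v => congrFun h v)

end Iso

end MomentTree

/-! ### Amplitudes and leaf counts of planar trees -/

namespace PlanarTree

variable {k : ℕ}

/-- The number of leaves with a given label. -/
def leafCount : PlanarTree k → Fin k → ℕ
  | leaf i, j => if i = j then 1 else 0
  | node _ _ c, j => ∑ i, leafCount (c i) j

/-- The product of the couplings of the nodes. -/
noncomputable def amplitude {A : Type*} [Fintype A] (K : KLProblem A k) : PlanarTree k → ℝ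
  | leaf _ => 1
  | node l d c => (-1) ^ d *
      KLProblem.expect K.q (fun a => K.obs l a * ∏ i, K.obs (c i).lab a) * ∏ i, amplitude K (c i)

theorem weight_eq {A : Type*} [Fintype A] (K : KLProblem A k) (x : Fin k → ℝ) (T : PlanarTree k) :
    K.weight x T = T.amplitude K / T.symmetry * ∏ i, x i ^ T.leafCount i := by
  induction T with
  | leaf i =>
    simp only [KLProblem.weight, amplitude, symmetry, leafCount]
    rw [Finset.prod_eq_single i (by intro j _ hj; simp [hj.symm]) (by simp)]
    simp
  | node l d c ih =>
    simp only [KLProblem.weight, amplitude, symmetry, leafCount, ih, Finset.prod_mul_distrib,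
      Finset.prod_div_distrib, ← Finset.prod_pow_eq_pow_sum]
    rw [Finset.prod_comm]
    push_cast
    ring

theorem childSet_eq_empty_or (T : PlanarTree k) (u : T.Vert) :
    (T.childSet u = ∅ ∧ T.vertLab u ≠ 0) ∨ 2 ≤ (T.childSet u).ncard := by
  induction T with
  | leaf i => exact Or.inl ⟨childSet_leaf i u, Fin.succ_ne_zero i⟩
  | node l d c ih =>
    induction u using node_cases with
    | root =>
      right
      rw [childSet_node_root, ← Set.image_univ,
        Set.ncard_image_of_injective _ inner_root_injective, Set.ncard_univ]
      simp
    | inner i u =>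
      rw [childSet_node_inner, Set.ncard_image_of_injective _ (inner_injective i),
        Set.image_eq_empty]
      exact ih i u

theorem prod_vert_node {M : Type*} [CommMonoid M] {l : Fin (k + 1)} {d : ℕ}
    {c : Fin (d + 2) → PlanarTree k} (f : (node l d c).Vert → M) :
    ∏ u, f u = f (node l d c).root * ∏ i, ∏ u, f (inner i u) :=
  (Fintype.prod_option (α := Σ i, (c i).Vert) f).trans
    (congrArg _ (Fintype.prod_sigma (fun x : Σ i, (c i).Vert => f (some x))))

theorem sum_vert_node {M : Type*} [AddCommMonoid M] {l : Fin (k + 1)} {d : ℕ}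
    {c : Fin (d + 2) → PlanarTree k} (f : (node l d c).Vert → M) :
    ∑ u, f u = f (node l d c).root + ∑ i, ∑ u, f (inner i u) :=
  (Fintype.sum_option (α := Σ i, (c i).Vert) f).trans
    (congrArg _ (Fintype.sum_sigma (fun x : Σ i, (c i).Vert => f (some x))))

/-- Adding the inequalities of the children gains 1 for each child. There are at least two, which
pays for the root and for the 1 on the left. -/
theorem card_vert_add_one_le (T : PlanarTree k) :
    Fintype.card T.Vert + 1 ≤ 2 * ∑ j, T.leafCount j := by
  induction T with
  | leaf i =>
    have h : ∑ j, (leaf i).leafCount j = 1 := by simp [leafCount]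
    rw [h]
    exact le_rfl
  | node l d c ih =>
    have h₁ : Fintype.card (node l d c).Vert = 1 + ∑ i, Fintype.card (c i).Vert := by
      simp only [Fintype.card, Finset.card_eq_sum_ones]
      exact sum_vert_node _
    have h₂ : ∑ j, (node l d c).leafCount j = ∑ i, ∑ j, (c i).leafCount j := by
      simp only [leafCount]
      exact Finset.sum_comm
    have h₃ := Finset.sum_le_sum fun i (_ : i ∈ Finset.univ) => ih i
    rw [Finset.sum_add_distrib, ← Finset.mul_sum] at h₃
    simp only [Finset.sum_const, Finset.card_univ, Fintype.card_fin, smul_eq_mul] at h₃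
    rw [h₁, h₂]
    omega

open Classical in
theorem card_leaves (T : PlanarTree k) (j : Fin k) :
    (∑ u, if T.childSet u = ∅ ∧ T.vertLab u = j.succ then 1 else 0) = T.leafCount j := by
  induction T with
  | leaf i =>
    simp only [childSet_leaf, true_and, vertLab, leafCount, Fin.succ_inj]
    exact Fintype.sum_unique (ι := Unit) _
  | node l d c ih =>
    rw [sum_vert_node, if_neg, zero_add, leafCount]
    · refine Finset.sum_congr rfl fun i _ => ?_
      rw [← ih]
      refine Finset.sum_congr rfl fun u _ => ?_
      simp only [childSet_node_inner, Set.image_eq_empty]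
      rfl
    · rw [childSet_node_root]
      exact fun h => (Set.range_nonempty _).ne_empty h.1

variable {A : Type*} [Fintype A]

/-- The coupling value of a node with its parent and its children as neighbours. -/
noncomputable def nodeCoupling (K : KLProblem A k) (T : PlanarTree k) (u : T.Vert) : ℝ :=
  (-1) ^ (T.childSet u).ncard * KLProblem.expect K.q
    (fun a => K.obs (T.vertLab u) a * ∏ᶠ w ∈ T.childSet u, K.obs (T.vertLab w) a)

theorem nodeCoupling_root (K : KLProblem A k) {l : Fin (k + 1)} {d : ℕ}
    {c : Fin (d + 2) → PlanarTree k} :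
    nodeCoupling K (node l d c) (node l d c).root = (-1) ^ d *
      KLProblem.expect K.q (fun a => K.obs l a * ∏ i, K.obs (c i).lab a) := by
  have h₁ : ((node l d c).childSet (node l d c).root).ncard = d + 2 := by
    rw [childSet_node_root, ← Set.image_univ,
      Set.ncard_image_of_injective _ inner_root_injective, Set.ncard_univ]
    simp
  rw [nodeCoupling, h₁, pow_add, neg_one_sq, mul_one, childSet_node_root]
  congr 2
  ext a
  rw [finprod_mem_range inner_root_injective, finprod_eq_prod_of_fintype]
  simp only [← vertLab_root]
  rfl

theorem nodeCoupling_inner (K : KLProblem A k) {l : Fin (k + 1)} {d : ℕ}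
    {c : Fin (d + 2) → PlanarTree k} (i : Fin (d + 2)) (u : (c i).Vert) :
    nodeCoupling K (node l d c) (inner i u) = nodeCoupling K (c i) u := by
  rw [nodeCoupling, nodeCoupling, childSet_node_inner,
    Set.ncard_image_of_injective _ (inner_injective i)]
  congr 2
  ext a
  rw [finprod_mem_image (inner_injective i).injOn]
  rfl

open Classical in
theorem prod_nodeCoupling (K : KLProblem A k) (T : PlanarTree k) :
    (∏ u, if T.childSet u = ∅ then 1 else nodeCoupling K T u) = T.amplitude K := by
  induction T with
  | leaf i =>
    simp only [childSet_leaf, if_true, Finset.prod_const_one, amplitude]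
  | node l d c ih =>
    rw [prod_vert_node, if_neg, nodeCoupling_root, amplitude]
    · congr 1
      refine Finset.prod_congr rfl fun i _ => ?_
      rw [← ih]
      refine Finset.prod_congr rfl fun u _ => ?_
      simp only [childSet_node_inner, Set.image_eq_empty, nodeCoupling_inner]
    · rw [childSet_node_root]
      exact (Set.range_nonempty _).ne_empty

end PlanarTree

/-! ### The moment tree underlying a planar tree -/

namespace PlanarTree

variable {k : ℕ} (T : PlanarTree k)

/-- The graph underlying a planar tree, with an additional vertex at the top. -/
def graph : SimpleGraph (Option T.Vert) where
  -- The option `T.parent u` is itself read as a vertex: the root, having no parent, is joined to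
  -- `none`, the distinguished leaf.
  Adj a b := (a ≠ none ∧ a.bind T.parent = b) ∨ (b ≠ none ∧ b.bind T.parent = a)
  symm := ⟨fun _ _ h => h.symm⟩
  loopless := ⟨fun a h => by
    have h' := h.elim id id
    cases a with
    | none => exact h'.1 rfl
    | some u => exact lt_irrefl _ (T.depth_lt h'.2)⟩

theorem isParentMap : T.graph.IsParentMap none (fun a => a.bind T.parent)
    (fun a => a.elim 0 fun u => T.depth u + 1) where
  adj_iff _ _ := Iff.rfl
  lt a ha := by
    cases a with
    | none => exact absurd rfl ha
    | some u =>
      change Option.elim (T.parent u) 0 _ < T.depth u + 1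
      cases h : T.parent u with
      | none => exact Nat.succ_pos _
      | some v => exact Nat.succ_lt_succ (T.depth_lt h)

open Classical in
/-- The labels of the edges of the graph underlying a planar tree. -/
noncomputable def edgeLab (e : Sym2 (Option T.Vert)) : Fin (k + 1) :=
  -- The lower end of an edge is unique, so the choice is immaterial.
  if h : ∃ u, e = s(some u, T.parent u) then T.vertLab h.choose else 0

theorem edgeLab_mk (u : T.Vert) : T.edgeLab s(some u, T.parent u) = T.vertLab u := by
  have h : ∃ v, s(some u, T.parent u) = s(some v, T.parent v) := ⟨u, rfl⟩
  rw [edgeLab, dif_pos h]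
  have := T.isParentMap.edge_injOn (Option.some_ne_none u) (Option.some_ne_none h.choose)
    h.choose_spec
  rw [← Option.some_injective _ this]

theorem setOf_parent_eq (u : T.Vert) :
    {w : Option T.Vert | w ≠ none ∧ w.bind T.parent = some u} = some '' T.childSet u := by
  ext w
  cases w with
  | none => simp
  | some w => simp [childSet]

theorem setOf_parent_eq_none :
    {w : Option T.Vert | w ≠ none ∧ w.bind T.parent = none} = {some T.root} := by
  ext w
  cases w with
  | none => simp
  | some w => simp [parent_eq_none_iff]

theorem ncard_neighborSet_some (u : T.Vert) :
    (T.graph.neighborSet (some u)).ncard = (T.childSet u).ncard + 1 := by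
  rw [T.isParentMap.ncard_neighborSet (Option.some_ne_none u), setOf_parent_eq,
    Set.ncard_image_of_injective _ (Option.some_injective _)]

/-- The moment tree underlying a planar tree. -/
noncomputable def toMomentTree : MomentTree k (Option T.Vert) where
  graph := T.graph
  isTree := T.isParentMap.isTree
  out := none
  label := T.edgeLab
  out_leaf := by
    rw [T.isParentMap.neighborSet_root, setOf_parent_eq_none, Set.ncard_singleton]
  valency a ha := by
    cases a with
    | none =>
      refine absurd ?_ ha
      rw [T.isParentMap.neighborSet_root, setOf_parent_eq_none, Set.ncard_singleton]
    | some u =>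
      rw [ncard_neighborSet_some] at ha ⊢
      rcases T.childSet_eq_empty_or u with h | h
      · rw [h.1, Set.ncard_empty] at ha
        exact absurd rfl ha
      · omega
  leaf_label a b ha h hab := by
    cases a with
    | none => exact absurd rfl ha
    | some u =>
      rw [ncard_neighborSet_some] at h
      rcases T.childSet_eq_empty_or u with h' | h'
      · rw [← SimpleGraph.mem_neighborSet, T.isParentMap.neighborSet_eq_insert ha,
          setOf_parent_eq, h'.1, Set.image_empty] at hab
        obtain rfl : b = T.parent u := by simpa using hab
        rw [edgeLab_mk]
        exact h'.2
      · omega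

theorem par_toMomentTree (u : T.Vert) : T.toMomentTree.par (some u) = T.parent u := by
  obtain ⟨δ, h⟩ := T.toMomentTree.exists_isParentMap
  exact T.isParentMap.map h (RelIso.refl _) rfl (Option.some_ne_none u)

theorem up_toMomentTree (u : T.Vert) : T.toMomentTree.up (some u) = T.vertLab u := by
  rw [MomentTree.up, par_toMomentTree]
  exact T.edgeLab_mk u

theorem mem_children_toMomentTree (u : T.Vert) (a : Option T.Vert) :
    some u ∈ T.toMomentTree.children a ↔ T.parent u = a := by
  rw [← par_toMomentTree]
  exact ⟨fun h => h.2, fun h => ⟨Option.some_ne_none u, h⟩⟩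

theorem none_notMem_children_toMomentTree (a : Option T.Vert) :
    none ∉ T.toMomentTree.children a := fun h => h.1 rfl

theorem children_toMomentTree (u : T.Vert) :
    T.toMomentTree.children (some u) = some '' T.childSet u := by
  ext w
  cases w with
  | none => simp [none_notMem_children_toMomentTree]
  | some w => simp [mem_children_toMomentTree, childSet]

theorem children_out_toMomentTree :
    T.toMomentTree.children T.toMomentTree.out = {some T.root} := by
  ext w
  cases w with
  | none => simp [none_notMem_children_toMomentTree]
  | some w =>
    rw [mem_children_toMomentTree]
    refine (T.parent_eq_none_iff w).trans ?_
    simp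

theorem some_ne_out (u : T.Vert) : some u ≠ T.toMomentTree.out := Option.some_ne_none u

theorem hasOutput_toMomentTree (j : Fin (k + 1)) : T.toMomentTree.HasOutput j ↔ T.lab = j := by
  rw [MomentTree.hasOutput_iff T.children_out_toMomentTree, up_toMomentTree, vertLab_root]

theorem leafIndex_toMomentTree : T.toMomentTree.leafIndex = T.leafCount := by
  classical
  ext j
  have h : {v | v ≠ T.toMomentTree.out ∧ T.toMomentTree.children v = ∅ ∧
      T.toMomentTree.up v = j.succ} = some '' {u | T.childSet u = ∅ ∧ T.vertLab u = j.succ} := by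
    ext a
    cases a with
    | none =>
      refine ⟨fun h => absurd rfl h.1, ?_⟩
      rintro ⟨u, -, hu⟩
      exact absurd hu (Option.some_ne_none u)
    | some u =>
      rw [(Option.some_injective _).mem_set_image]
      simp [some_ne_out, children_toMomentTree, up_toMomentTree]
  rw [MomentTree.leafIndex_eq_ncard, h, Set.ncard_image_of_injective _ (Option.some_injective _),
    ← card_leaves, ← Finset.card_filter, ← Set.ncard_coe_finset]
  congr 1
  ext u
  simp

theorem coupling_toMomentTree {A : Type*} [Fintype A] (K : KLProblem A k) (u : T.Vert) :
    T.toMomentTree.coupling K (some u) = nodeCoupling K T u := by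
  rw [MomentTree.coupling_eq K (T.some_ne_out u), children_toMomentTree, up_toMomentTree,
    Set.ncard_image_of_injective _ (Option.some_injective _), nodeCoupling]
  congr 2
  ext a
  rw [finprod_mem_image (Option.some_injective _).injOn]
  simp only [up_toMomentTree]

theorem amplitude_toMomentTree {A : Type*} [Fintype A] (K : KLProblem A k) :
    T.toMomentTree.amplitude K = T.amplitude K := by
  classical
  have hout : T.toMomentTree.deg none = 1 := T.toMomentTree.out_leaf
  rw [MomentTree.amplitude, Finset.prod_filter, Fintype.prod_option, ← prod_nodeCoupling,
    if_neg (not_not.2 hout), one_mul]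
  refine Finset.prod_congr rfl fun u _ => ?_
  have h : T.toMomentTree.deg (some u) = 1 ↔ T.childSet u = ∅ := by
    rw [MomentTree.deg_eq_one_iff (T.some_ne_out u), children_toMomentTree, Set.image_eq_empty]
  simp only [coupling_toMomentTree, ne_eq, h, ite_not]

variable {T} {V : Type*} [Fintype V] {Γ : MomentTree k V} {t : V}

/-- An isomorphism that fixes the distinguished leaf respects parents, hence sets of children and
the labels of the edges above the vertices. -/
theorem isPlanarChart_of_iso (ht : Γ.children Γ.out = {t}) (φ : MomentTree.Iso T.toMomentTree Γ) :
    IsPlanarChart Γ.children Γ.up T t (fun u => φ.1 (some u)) := by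
  obtain ⟨f, ho, hl⟩ := φ
  change IsPlanarChart Γ.children Γ.up T t (fun u => f (some u))
  obtain ⟨δ, h⟩ := Γ.exists_isParentMap
  have hpar : ∀ u, Γ.par (f (some u)) = f (T.parent u) := fun u =>
    T.isParentMap.map h f ho (Option.some_ne_none u)
  have hne : ∀ u, f (some u) ≠ Γ.out := fun u hu =>
    T.some_ne_out u (f.injective (hu.trans ho.symm))
  have hroot : T.parent T.root = none := (T.parent_eq_none_iff _).2 rfl
  refine ⟨?_, fun u => ?_, fun u => ⟨fun w hw => ⟨hne w, ?_⟩, fun w _ w' _ hw =>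
    Option.some_injective _ (f.injective hw), fun w hw => ?_⟩⟩
  · have : f (some T.root) ∈ Γ.children Γ.out := ⟨hne _, by rw [hpar, hroot]; exact ho⟩
    rwa [ht] at this
  · rw [MomentTree.up, hpar]
    have hadj : T.toMomentTree.graph.Adj (some u) (T.parent u) :=
      Or.inl ⟨Option.some_ne_none u, rfl⟩
    rw [hl _ _ hadj]
    exact T.edgeLab_mk u
  · rw [hpar]
    exact congrArg f hw
  · obtain ⟨a, rfl⟩ := f.surjective w
    cases a with
    | none => exact absurd ho hw.1
    | some w =>
      refine ⟨w, ?_, rfl⟩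
      have := hw.2
      rw [hpar] at this
      exact f.injective this

variable {f : T.Vert → V}

theorem IsPlanarChart.par_apply (hf : IsPlanarChart Γ.children Γ.up T t f)
    (ht : Γ.children Γ.out = {t}) (u : T.Vert) :
    f u ≠ Γ.out ∧ Γ.par (f u) = (T.parent u).elim Γ.out f := by
  cases h : T.parent u with
  | none =>
    rw [(T.parent_eq_none_iff u).1 h, hf.root]
    have : t ∈ Γ.children Γ.out := by rw [ht]; rfl
    exact this
  | some v => exact (hf.bijOn v).mapsTo h

/-- The local bijections on children are glued along parents. Vertices with equal images have
parents with equal images, which coincide by induction on depth, so the vertices are siblings and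
equal. Surjectivity goes by induction on the distance function δ of Γ. -/
theorem IsPlanarChart.bijective (hf : IsPlanarChart Γ.children Γ.up T t f)
    (ht : Γ.children Γ.out = {t}) :
    Function.Bijective fun a : Option T.Vert => a.elim Γ.out f := by
  have hinj : ∀ n u, T.depth u = n → ∀ v, f u = f v → u = v := by
    intro n
    induction n using Nat.strong_induction_on with
    | _ n ih =>
      intro u hn v huv
      have hu := (hf.par_apply ht u).2
      have hv := (hf.par_apply ht v).2
      rw [huv, hv] at hu
      cases hpu : T.parent u with
      | none =>
        cases hpv : T.parent v with
        | none => rw [(T.parent_eq_none_iff u).1 hpu, (T.parent_eq_none_iff v).1 hpv]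
        | some b =>
          rw [hpu, hpv] at hu
          exact absurd hu (hf.par_apply ht b).1
      | some a =>
        cases hpv : T.parent v with
        | none =>
          rw [hpu, hpv] at hu
          exact absurd hu.symm (hf.par_apply ht a).1
        | some b =>
          rw [hpu, hpv] at hu
          obtain rfl := ih _ (hn ▸ T.depth_lt hpu) a rfl b hu.symm
          exact (hf.bijOn a).injOn hpu hpv huv
  constructor
  · intro a b hab
    cases a with
    | none =>
      cases b with
      | none => rfl
      | some v => exact absurd hab.symm (hf.par_apply ht v).1
    | some u =>
      cases b with
      | none => exact absurd hab (hf.par_apply ht u).1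
      | some v => exact congrArg some (hinj _ u rfl v hab)
  · obtain ⟨δ, h⟩ := Γ.exists_isParentMap
    intro w
    induction hn : δ w using Nat.strong_induction_on generalizing w with
    | _ n ih =>
      subst hn
      by_cases hw : w = Γ.out
      · exact ⟨none, hw.symm⟩
      · obtain ⟨a, ha⟩ := ih _ (h.lt w hw) (Γ.par w) rfl
        cases a with
        | none =>
          have : w ∈ Γ.children Γ.out := ⟨hw, ha.symm⟩
          rw [ht] at this
          exact ⟨some T.root, hf.root.trans this.symm⟩
        | some u =>
          obtain ⟨u', -, hu'⟩ := (hf.bijOn u).surjOn (show w ∈ Γ.children (f u) from ⟨hw, ha.symm⟩)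
          exact ⟨some u', hu'⟩

theorem exists_iso_of_isPlanarChart (ht : Γ.children Γ.out = {t})
    (hf : IsPlanarChart Γ.children Γ.up T t f) :
    ∃ φ : MomentTree.Iso T.toMomentTree Γ, ∀ u, φ.1 (some u) = f u := by
  obtain ⟨δ, h⟩ := Γ.exists_isParentMap
  let φ : Option T.Vert ≃ V := Equiv.ofBijective _ (hf.bijective ht)
  have hφ : ∀ a, a ≠ none → Γ.par (φ a) = φ (a.bind T.parent) := fun a ha => by
    cases a with
    | none => exact absurd rfl ha
    | some u => exact (hf.par_apply ht u).2
  have hlab : ∀ a, a ≠ none →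
      Γ.label s(φ a, φ (a.bind T.parent)) = T.edgeLab s(a, a.bind T.parent) := fun a ha => by
    cases a with
    | none => exact absurd rfl ha
    | some u =>
      rw [← hφ _ ha]
      exact (hf.lab u).trans (T.edgeLab_mk u).symm
  refine ⟨⟨⟨φ, T.isParentMap.map_adj_iff h φ rfl hφ⟩, rfl, fun a b hab => ?_⟩, fun _ => rfl⟩
  change Γ.label s(φ a, φ b) = T.edgeLab s(a, b)
  rcases hab with ⟨ha, rfl⟩ | ⟨hb, rfl⟩
  · exact hlab a ha
  · rw [Sym2.eq_swap, Sym2.eq_swap (a := b.bind T.parent)]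
    exact hlab b hb

theorem card_iso_toMomentTree (T : PlanarTree k) (ht : Γ.children Γ.out = {t}) :
    Nat.card (MomentTree.Iso T.toMomentTree Γ) = Nat.card (Chart Γ.children Γ.up T t) := by
  refine Nat.card_eq_of_bijective (fun φ => ⟨_, isPlanarChart_of_iso ht φ⟩) ⟨fun φ ψ h => ?_, ?_⟩
  · refine Subtype.ext (RelIso.ext fun a => ?_)
    cases a with
    | none => exact φ.2.1.trans ψ.2.1.symm
    | some u => exact congrFun (congrArg Subtype.val h) u
  · rintro ⟨f, hf⟩
    obtain ⟨φ, hφ⟩ := exists_iso_of_isPlanarChart ht hf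
    exact ⟨φ, Subtype.ext (funext hφ)⟩

end PlanarTree

/-! ### The mass of the planar trees over a moment tree -/

namespace MomentTree

variable {k : ℕ} {V : Type*} [Fintype V] (Γ : MomentTree k V)

theorem hasSum_card_iso : HasSum (fun T : PlanarTree k =>
    (Nat.card (Iso T.toMomentTree Γ) : ℝ) / T.symmetry) 1 := by
  obtain ⟨t, ht⟩ := Γ.exists_children_out
  obtain ⟨δ, h⟩ := Γ.exists_isParentMap
  simp only [PlanarTree.card_iso_toMomentTree _ ht]
  -- The distinguished leaf has exactly one child and must be excluded; the count starts at its
  -- neighbour `t`.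
  refine PlanarTree.hasSum_card_chart δ {v | v ≠ Γ.out} (fun v hv w hw => ⟨hw.1, ?_⟩)
    (fun v hv => children_eq_empty_or hv) t ?_
  · rw [← hw.2]
    exact h.lt w hw.1
  · have : t ∈ Γ.children Γ.out := by rw [ht]; rfl
    exact this.1

/-- Transport of a moment tree along a bijection of the sets of vertices. -/
def copy {W : Type*} [Fintype W] (e : V ≃ W) : MomentTree k W :=
  have hn : ∀ w, ((Γ.graph.comap e.symm).neighborSet w).ncard =
      (Γ.graph.neighborSet (e.symm w)).ncard := fun w =>
    Nat.card_congr ((SimpleGraph.Iso.comap e.symm Γ.graph).mapNeighborSet w)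
  { graph := Γ.graph.comap e.symm
    isTree := (SimpleGraph.Iso.comap e.symm Γ.graph).isTree_iff.2 Γ.isTree
    out := e Γ.out
    label := fun s => Γ.label (s.map e.symm)
    out_leaf := by rw [hn, e.symm_apply_apply, Γ.out_leaf]
    valency := fun w hw => by
      rw [hn] at hw ⊢
      exact Γ.valency _ hw
    leaf_label := fun w w' hw h hadj => by
      rw [hn] at h
      exact Γ.leaf_label _ _ (fun hw' => hw (by rw [← hw', e.apply_symm_apply])) h hadj }

def isoCopy {W : Type*} [Fintype W] (e : V ≃ W) : Iso Γ (Γ.copy e) :=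
  ⟨(SimpleGraph.Iso.comap e.symm Γ.graph).symm, rfl, fun u v _ => by
    change Γ.label s(e.symm (e u), e.symm (e v)) = _
    rw [e.symm_apply_apply, e.symm_apply_apply]⟩

/-- A series with sum 1 has a nonzero term, so the weighted count already yields a planar ordering.
-/
theorem exists_iso_toMomentTree : ∃ T : PlanarTree k, Nonempty (Iso T.toMomentTree Γ) := by
  by_contra h
  push Not at h
  have h₁ := Γ.hasSum_card_iso
  simp only [Nat.card_of_isEmpty, Nat.cast_zero, zero_div] at h₁
  exact zero_ne_one (hasSum_zero.unique h₁)

/-- The planar trees with a given underlying moment tree have, counted with weights, mass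
`1 / |Aut|`. -/
theorem hasSum_symmetry_inv [∀ T : PlanarTree k, Decidable (Nonempty (Iso T.toMomentTree Γ))] :
    HasSum (fun T : PlanarTree k =>
      if Nonempty (Iso T.toMomentTree Γ) then (1 : ℝ) / T.symmetry else 0)
      (1 / (Nat.card Γ.Aut : ℝ)) := by
  have : Nonempty Γ.Aut := ⟨Iso.refl Γ⟩
  have h₁ : (Nat.card Γ.Aut : ℝ) ≠ 0 := Nat.cast_ne_zero.2 Nat.card_pos.ne'
  have h₂ := Γ.hasSum_card_iso.mul_left (1 / (Nat.card Γ.Aut : ℝ))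
  rw [mul_one] at h₂
  have heq : (fun T : PlanarTree k =>
      if Nonempty (Iso T.toMomentTree Γ) then (1 : ℝ) / T.symmetry else 0) = fun T =>
        1 / (Nat.card Γ.Aut : ℝ) * ((Nat.card (Iso T.toMomentTree Γ) : ℝ) / T.symmetry) := by
    ext T
    split_ifs with h
    · obtain ⟨φ⟩ := h
      rw [φ.card_eq_card_aut, ← mul_div_assoc, one_div_mul_cancel h₁]
    · have := not_nonempty_iff.1 h
      simp
  rw [heq]
  exact h₂

end MomentTree

/-! ### Finiteness and the sum over isomorphism types -/

namespace MomentTree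

variable {k : ℕ}

instance finite (V : Type*) [Fintype V] : Finite (MomentTree k V) := by
  classical
  refine Finite.of_injective
    (fun Γ : MomentTree k V => (Γ.graph, Γ.out, Γ.label)) fun Γ Δ h => ?_
  cases Γ
  cases Δ
  simp only [Prod.mk.injEq] at h
  obtain ⟨rfl, rfl, rfl⟩ := h
  rfl

theorem card_le_two_mul_sum_leafIndex {V : Type*} [Fintype V] (Γ : MomentTree k V) :
    Fintype.card V ≤ 2 * ∑ i, Γ.leafIndex i := by
  obtain ⟨T, ⟨φ⟩⟩ := Γ.exists_iso_toMomentTree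
  rw [← Fintype.card_congr φ.1.toEquiv, Fintype.card_option, φ.leafIndex_eq,
    T.leafIndex_toMomentTree]
  exact T.card_vert_add_one_le

end MomentTree

instance IndexedMomentTree.finite (k : ℕ) (j : Fin (k + 1)) (I : Fin k → ℕ) :
    Finite (IndexedMomentTree k j I) := by
  have hn : ∀ Γ : IndexedMomentTree k j I, Γ.n < 2 * ∑ i, I i + 1 := fun Γ => by
    have := Γ.tree.card_le_two_mul_sum_leafIndex
    rw [Fintype.card_fin, Γ.leafIndex_eq] at this
    omega
  refine Finite.of_injective (β := Σ n : Fin (2 * ∑ i, I i + 1), MomentTree k (Fin n))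
    (fun Γ => ⟨⟨Γ.n, hn Γ⟩, Γ.tree⟩) fun Γ Δ h => ?_
  obtain ⟨n, tree, _, _⟩ := Γ
  obtain ⟨m, tree', _, _⟩ := Δ
  simp only [Sigma.mk.injEq, Fin.mk.injEq] at h
  obtain ⟨rfl, h⟩ := h
  obtain rfl := eq_of_heq h
  rfl

namespace MomentTreeType

variable {k : ℕ} {j : Fin (k + 1)} {I : Fin k → ℕ}

instance finite (k : ℕ) (j : Fin (k + 1)) (I : Fin k → ℕ) : Finite (MomentTreeType k j I) :=
  Quotient.finite _

theorem exists_iso_rep {T : PlanarTree k} (hj : T.lab = j) (hI : T.leafCount = I) :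
    ∃ c : MomentTreeType k j I, Nonempty (MomentTree.Iso T.toMomentTree c.rep.tree) := by
  let φ := T.toMomentTree.isoCopy (Fintype.equivFin _)
  let Γ : IndexedMomentTree k j I :=
    ⟨_, T.toMomentTree.copy (Fintype.equivFin _), φ.hasOutput ((T.hasOutput_toMomentTree j).2 hj),
      by rw [φ.leafIndex_eq, T.leafIndex_toMomentTree, hI]⟩
  let c : MomentTreeType k j I := Quotient.mk (IndexedMomentTree.setoid k j I) Γ
  have h : (IndexedMomentTree.setoid k j I) c.rep Γ := Quotient.exact (Quotient.out_eq c)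
  exact ⟨c, h.map fun ψ => φ.trans ψ.symm⟩

theorem eq_of_iso_rep {T : PlanarTree k} {c c' : MomentTreeType k j I}
    (h : Nonempty (MomentTree.Iso T.toMomentTree c.rep.tree))
    (h' : Nonempty (MomentTree.Iso T.toMomentTree c'.rep.tree)) : c = c' := by
  obtain ⟨φ⟩ := h
  obtain ⟨ψ⟩ := h'
  rw [← Quotient.out_eq c, ← Quotient.out_eq c']
  exact Quotient.sound ⟨φ.symm.trans ψ⟩

theorem lab_and_leafCount_of_iso_rep {T : PlanarTree k} {c : MomentTreeType k j I}
    (φ : MomentTree.Iso T.toMomentTree c.rep.tree) : T.lab = j ∧ T.leafCount = I := by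
  rw [← T.hasOutput_toMomentTree, ← T.leafIndex_toMomentTree, ← φ.leafIndex_eq]
  exact ⟨φ.symm.hasOutput c.rep.hasOutput, c.rep.leafIndex_eq⟩

/-- The sum over the isomorphism types of moment trees is a sum over planar trees. -/
theorem hasSum_amplitude_div_symmetry {A : Type*} [Fintype A] (K : KLProblem A k)
    (j : Fin (k + 1)) (I : Fin k → ℕ) :
    HasSum (fun T : PlanarTree k =>
      if T.lab = j ∧ T.leafCount = I then T.amplitude K / T.symmetry else 0)
      (∑ᶠ c : MomentTreeType k j I, c.rep.tree.amplitude K / (Nat.card c.rep.tree.Aut : ℝ)) := by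
  classical
  have := Fintype.ofFinite (MomentTreeType k j I)
  have h := hasSum_sum (s := Finset.univ) fun (c : MomentTreeType k j I) _ =>
    c.rep.tree.hasSum_symmetry_inv.mul_left (c.rep.tree.amplitude K)
  simp only [mul_one_div] at h
  rw [finsum_eq_sum_of_fintype]
  -- A planar tree lies over exactly one isomorphism type if its root label and leaf counts match,
  -- and over none otherwise, so the sum over `c` collapses.
  have heq : (fun T : PlanarTree k =>
      if T.lab = j ∧ T.leafCount = I then T.amplitude K / T.symmetry else 0) = fun T =>
      ∑ c : MomentTreeType k j I, c.rep.tree.amplitude K *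
        if Nonempty (MomentTree.Iso T.toMomentTree c.rep.tree) then 1 / (T.symmetry : ℝ) else 0 := by
    ext T
    split_ifs with hT
    · obtain ⟨c, hc⟩ := exists_iso_rep hT.1 hT.2
      rw [Finset.sum_eq_single c, if_pos hc, mul_one_div]
      · obtain ⟨φ⟩ := hc
        rw [φ.amplitude_eq, T.amplitude_toMomentTree]
      · intro c' _ hc'
        rw [if_neg fun h' => hc' (eq_of_iso_rep h' hc), mul_zero]
      · exact fun hc' => absurd (Finset.mem_univ c) hc'
    · refine (Finset.sum_eq_zero fun c _ => ?_).symm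
      rw [if_neg fun ⟨φ⟩ => hT (lab_and_leafCount_of_iso_rep φ), mul_zero]
  rw [heq]
  exact h

end MomentTreeType

/-! ### The Taylor series of the exponential parameters -/

namespace KLProblem

variable {A : Type*} [Fintype A] {k : ℕ} {K : KLProblem A k}

/-- The planar trees are grouped by leaf multi-index I. On each fibre the leaf values have the
constant product (-ρ)^I, the source of the sign (-1)^|I|. -/
theorem hasSum_treeSum {ρ : Fin k → ℝ} (h : Summable fun T => ‖K.weight (-ρ) T‖)
    (j : Fin (k + 1)) :
    HasSum (fun I : Fin k → ℕ => (-1) ^ (∑ i, I i) *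
        (∑ᶠ c : MomentTreeType k j I, c.rep.tree.amplitude K / (Nat.card c.rep.tree.Aut : ℝ)) *
        ∏ i, ρ i ^ I i) (K.treeSum (-ρ) j) := by
  obtain ⟨F, hF⟩ : ∃ F : PlanarTree k → ℝ,
      F = fun T => if T.lab = j then K.weight (-ρ) T else 0 := ⟨_, rfl⟩
  have h₀ : HasSum F (K.treeSum (-ρ) j) := hF ▸ (summable_weight_ite h j).hasSum
  refine ((Equiv.sigmaFiberEquiv (PlanarTree.leafCount (k := k))).hasSum_iff.2 h₀).sigma
    fun I => ?_
  have h₂ := (MomentTreeType.hasSum_amplitude_div_symmetry K j I).mul_left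
    ((-1) ^ (∑ i, I i) * ∏ i, ρ i ^ I i)
  rw [mul_right_comm]
  refine (hasSum_subtype_iff_indicator (s := {T : PlanarTree k | T.leafCount = I})
    (f := F)).2 ?_
  have heq : Set.indicator {T : PlanarTree k | T.leafCount = I} F = fun T =>
      ((-1) ^ (∑ i, I i) * ∏ i, ρ i ^ I i) *
        if T.lab = j ∧ T.leafCount = I then T.amplitude K / (T.symmetry : ℝ) else 0 := by
    ext T
    by_cases hI : T.leafCount = I
    · rw [Set.indicator_of_mem (show T ∈ {T : PlanarTree k | T.leafCount = I} from hI), hF]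
      by_cases hj : T.lab = j
      · simp only [hj, hI, and_self, if_true, PlanarTree.weight_eq, Pi.neg_apply, neg_pow (ρ _),
          Finset.prod_mul_distrib, Finset.prod_pow_eq_pow_sum]
        ring
      · simp only [hj, false_and, if_false, mul_zero]
    · rw [Set.indicator_of_notMem (show T ∉ {T : PlanarTree k | T.leafCount = I} from hI),
        if_neg fun h => hI h.2, mul_zero]
  rw [heq]
  exact h₂

theorem eventually_summable_weight (K : KLProblem A k) :
    ∀ᶠ ρ in 𝓝 (0 : Fin k → ℝ), Summable fun T => ‖K.weight (-ρ) T‖ := by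
  obtain ⟨ε, hε, h⟩ := K.exists_summable_weight
  filter_upwards [Metric.ball_mem_nhds (0 : Fin k → ℝ) hε] with ρ hρ
  refine h _ fun i => ?_
  rw [mem_ball_zero_iff] at hρ
  rw [Pi.neg_apply, abs_neg]
  exact (norm_le_pi_norm ρ i).trans hρ.le

end KLProblem

theorem mainTheorem1 {A : Type*} [Fintype A] {k : ℕ} (K : KLProblem A k) (hK : K.Normalized) :
    (∀ᶠ ρ in 𝓝 (0 : Fin k → ℝ), ∃! l : ℝ × (Fin k → ℝ), K.IsExpParameters ρ l) ∧
    (∀ (j : Fin k) (I : Fin k → ℕ), Finite (MomentTreeType k j.succ I)) ∧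
    ∀ lam : (Fin k → ℝ) → ℝ × (Fin k → ℝ),
      (∀ᶠ ρ in 𝓝 (0 : Fin k → ℝ), K.IsExpParameters ρ (lam ρ)) →
      ∀ j : Fin k,
        HasTaylorCoefficients (fun ρ => (lam ρ).2 j) (fun I =>
          (-1) ^ (∑ i, I i) *
            ∑ᶠ c : MomentTreeType k j.succ I,
              c.rep.tree.amplitude K / (Nat.card c.rep.tree.Aut : ℝ)) := by
  refine ⟨?_, fun j I => inferInstance, fun lam hlam j => ?_⟩
  · filter_upwards [K.eventually_summable_weight] with ρ hρ
    exact ⟨_, KLProblem.isExpParameters_treeSum hK hρ,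
      fun l hl => hl.unique hK (KLProblem.isExpParameters_treeSum hK hρ)⟩
  · filter_upwards [K.eventually_summable_weight, hlam] with ρ hρ hl
    rw [hl.unique hK (KLProblem.isExpParameters_treeSum hK hρ)]
    exact KLProblem.hasSum_treeSum hρ j.succ
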